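/- **Setting.** Let $\Pi$ be a Polish space with its Borel $\sigma$-algebra, $\nu$ a finite Borel measure on $\Pi$, $N\ge 2$, and $\boldsymbol\nu=\nu^{\otimes N}$ on $\Pi^N$. An *adjoint Markov semigroup* on $L^1(\nu)$ is a $C_0$-semigroup $\{S_t\}_{t\ge0}$ on $L^1(\nu)$ with $S_t\rho\ge0$ whenever $\rho\ge 0$, and $\int S_t\rho\,d\nu=\int\rho\,d\nu$ for all $\rho\in L^1(\nu)$, $t\ge0$. Its infinitesimal generator is $\rho\mapsto\lim_{h\downarrow0}(S_h\rho-\rho)/h$, with domain all $\rho$ for which the limit exists in $L^1(\nu)$; such an operator is called an *adjoint Markov generator*. The same definitions are used on $(\Pi^N,\boldsymbol\nu)$. Let $\hat{\mathcal P}_N(\Pi)=\{\frac1{N-1}\sum_{i=1}^{N-1}\delta_{z_i}: z_i\in\Pi\}$, and for $z\in\Pi^{N-1}$ put $\mu(z)=\frac1{N-1}\sum_i\delta_{z_i}$. Let $\Lambda$ assign to each $\mu\in\hat{\mathcal P}_N(\Pi)$ a bounded Markov jump kernel $\Lambda(x,dy;\mu)$ on $\Pi$ (a positive kernel with $\sup_x\Lambda(x,\Pi;\mu)<\infty$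 and $\Lambda(x,\{x\};\mu)=0$ for every $x$), such that $(x,z)\mapsto\Lambda(x,E;\mu(z))$ is measurable on $\Pi\times\Pi^{N-1}$ for every Borel set $E$. Assume (A1) $\sup_{\mu\in\hat{\mathcal P}_N(\Pi)}\sup_{x}\Lambda(x,\Pi;\mu)<\infty$, and for each $\mu\in\hat{\mathcal P}_N(\Pi)$ the kernel $\Lambda(\mu)$ has an adjoint kernel $\Lambda^*(\mu)$: a positive kernel, finite at every point, with $\Lambda(x,dy;\mu)\,\nu(dx)=\Lambda^*(y,dx;\mu)\,\nu(dy)$ as measures on $\Pi^2$. Write $\mathcal A^*(\rho;\mu)(x)=\int\rho(y)\,\Lambda^*(x,dy;\mu)-\Lambda(x,\Pi;\mu)\rho(x)$ for $\rho\in L^1(\nu)$. Let $\mathcal K^*$ be an adjoint Markov generator on $L^1(\nu)$. For $1\le k\le N$ let $\mathcal K^{*(k)}=I^{\otimes(k-1)}\otimes\mathcal K^*\otimes I^{\otimes(N-k)}$ on $L^1(\boldsymbol\nu)$ (the closure of the operator defined on the span of the products $f_1\otimes\dots\otimes f_N$ with $f_i\in L^1(\nu)$ and $f_k\in D(\mathcal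 K^*)$), and let $\mathcal A^{*(k)}$ be the operator on $L^1(\boldsymbol\nu)$ which, for a.e. $\boldsymbol x_{-k}\in\Pi^{N-1}$, applies $\mathcal A^*(\,\cdot\,;\mu(\boldsymbol x_{-k}))$ to $x_k\mapsto\boldsymbol\rho(\boldsymbol x)$, where $\boldsymbol x_{-k}$ is $\boldsymbol x$ with its $k$-th coordinate removed. Let $\boldsymbol{\mathcal L}_N^*=\sum_{k=1}^N\big(\mathcal K^{*(k)}+\mathcal A^{*(k)}\big)$, understood as the closure of this sum on the intersection of the domains. **Proposition.** $\boldsymbol{\mathcal L}_N^*$ is an adjoint Markov generator on $L^1(\boldsymbol\nu)$: there is an adjoint Markov semigroup (a positive, mass-conserving $C_0$-semigroup) on $L^1(\boldsymbol\nu)$ whose infinitesimal generator is $\boldsymbol{\mathcal L}_N^*$. -/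

import Mathlib

open MeasureTheory ProbabilityTheory Filter Topology
open scoped NNReal ENNReal

noncomputable section

namespace MeanFieldJump

/-! ### Adjoint Markov semigroups and their generators -/

/-- A `C₀`-semigroup `(S t)_{t ≥ 0}` of bounded operators on a real normed space. -/
structure IsC0Semigroup {E : Type*} [NormedAddCommGroup E] [NormedSpace ℝ E]
    (S : ℝ≥0 → E →L[ℝ] E) : Prop where
  map_zero : S 0 = ContinuousLinearMap.id ℝ E
  map_add : ∀ s t, S (s + t) = (S s).comp (S t)
  tendsto_zero : ∀ ρ, Tendsto (fun t => S t ρ) (𝓝 0) (𝓝 ρ)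

/-- The (unbounded) operator `K` is the infinitesimal generator of `S`: its domain consists of
exactly those `ρ` for which `lim_{h ↘ 0} (S h ρ - ρ) / h` exists in norm, and `K ρ` is this
limit. -/
def IsInfinitesimalGenerator {E : Type*} [NormedAddCommGroup E] [NormedSpace ℝ E]
    (S : ℝ≥0 → E →L[ℝ] E) (K : E →ₗ.[ℝ] E) : Prop :=
  ∀ ρ η : E, (ρ, η) ∈ K.graph ↔
    Tendsto (fun h : ℝ≥0 => (h : ℝ)⁻¹ • (S h ρ - ρ)) (𝓝[>] 0) (𝓝 η)

/-- An adjoint Markov semigroup on `L¹(ν)`: a positive, mass-conserving `C₀`-semigroup. -/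
structure IsAdjointMarkovSemigroup {X : Type*} [MeasurableSpace X] (ν : Measure X)
    (S : ℝ≥0 → Lp ℝ 1 ν →L[ℝ] Lp ℝ 1 ν) : Prop extends IsC0Semigroup S where
  nonneg : ∀ t ρ, 0 ≤ ρ → 0 ≤ S t ρ
  integral_eq : ∀ t (ρ : Lp ℝ 1 ν), ∫ x, S t ρ x ∂ν = ∫ x, ρ x ∂ν

/-- An adjoint Markov generator on `L¹(ν)`. -/
def IsAdjointMarkovGenerator {X : Type*} [MeasurableSpace X] (ν : Measure X)
    (K : Lp ℝ 1 ν →ₗ.[ℝ] Lp ℝ 1 ν) : Prop :=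
  ∃ S : ℝ≥0 → Lp ℝ 1 ν →L[ℝ] Lp ℝ 1 ν,
    IsAdjointMarkovSemigroup ν S ∧ IsInfinitesimalGenerator S K

/-! ### Adjoint kernels and adjoint jump generators -/

/-- `Λs` is an adjoint kernel of `Λ` with respect to `ν`: it is a positive kernel (a finite measure
at every point) and `Λ(x, dy) ν(dx) = Λs(y, dx) ν(dy)` as measures on `X × X`. -/
structure IsAdjointKernel {X : Type*} [MeasurableSpace X] (ν : Measure X)
    (Λ Λs : Kernel X X) : Prop where
  finite : ∀ y, IsFiniteMeasure (Λs y)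
  lintegral_eq : ∀ F : X × X → ℝ≥0∞, Measurable F →
    ∫⁻ x, ∫⁻ y, F (x, y) ∂(Λ x) ∂ν = ∫⁻ y, ∫⁻ x, F (x, y) ∂(Λs y) ∂ν

/-- The function `x ↦ ∫ ρ(y) Λs(x, dy) - Λ(x, X) ρ(x)`. -/
def adjointJumpFun {X : Type*} [MeasurableSpace X] (Λ Λs : Kernel X X) (ρ : X → ℝ) : X → ℝ :=
  fun x => ∫ y, ρ y ∂(Λs x) - (Λ x).real Set.univ * ρ x

section AdjointJump

variable {X : Type*} [MeasurableSpace X] {ν : Measure X} {Λ Λs : Kernel X X}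

theorem IsAdjointKernel.ae_ae (h : IsAdjointKernel ν Λ Λs) {p : X → Prop} (hp : ∀ᵐ x ∂ν, p x) :
    ∀ᵐ y ∂ν, ∀ᵐ x ∂(Λs y), p x := by
  obtain ⟨s, hs, hsm, hs0⟩ := exists_measurable_superset_of_null hp
  have key := h.lintegral_eq (fun q => s.indicator 1 q.1)
    ((measurable_one.indicator hsm).comp measurable_fst)
  have h0 : ∫⁻ x, ∫⁻ _, s.indicator (1 : X → ℝ≥0∞) x ∂(Λ x) ∂ν = 0 := by
    rw [← lintegral_zero (μ := ν)]
    refine lintegral_congr_ae ?_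
    filter_upwards [measure_eq_zero_iff_ae_notMem.1 hs0] with x hx
    simp [hx]
  simp only [h0, lintegral_indicator_one hsm] at key
  have := (lintegral_eq_zero_iff (Λs.measurable_coe hsm)).1 key.symm
  filter_upwards [this] with y hy
  exact measure_mono_null hs hy

theorem IsAdjointKernel.lintegral_enorm_le (h : IsAdjointKernel ν Λ Λs) {M : ℝ≥0}
    (hM : ∀ x, Λ x Set.univ ≤ M) {f : X → ℝ} (hf : Measurable f) :
    ∫⁻ y, ∫⁻ x, ‖f x‖ₑ ∂(Λs y) ∂ν ≤ M * ∫⁻ x, ‖f x‖ₑ ∂ν := by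
  rw [← h.lintegral_eq (fun q => ‖f q.1‖ₑ) (hf.enorm.comp measurable_fst),
    ← lintegral_const_mul _ hf.enorm]
  refine lintegral_mono fun x => ?_
  simp only [lintegral_const]
  rw [mul_comm]
  gcongr
  exact hM x

theorem IsAdjointKernel.ae_integrable (h : IsAdjointKernel ν Λ Λs) {M : ℝ≥0}
    (hM : ∀ x, Λ x Set.univ ≤ M) (ρ : Lp ℝ 1 ν) : ∀ᵐ y ∂ν, Integrable ρ (Λs y) := by
  have hρ : Measurable ρ := (Lp.stronglyMeasurable ρ).measurable
  have hlt : ∫⁻ y, ∫⁻ x, ‖ρ x‖ₑ ∂(Λs y) ∂ν ≠ ∞ :=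
    ((h.lintegral_enorm_le hM hρ).trans_lt
      (ENNReal.mul_lt_top ENNReal.coe_lt_top (L1.integrable_coeFn ρ).2)).ne
  filter_upwards [ae_lt_top hρ.enorm.lintegral_kernel hlt] with y hy
  exact ⟨hρ.aestronglyMeasurable, hy⟩

theorem IsAdjointKernel.integrable_adjointJumpFun (h : IsAdjointKernel ν Λ Λs) {M : ℝ≥0}
    (hM : ∀ x, Λ x Set.univ ≤ M) (ρ : Lp ℝ 1 ν) : Integrable (adjointJumpFun Λ Λs ρ) ν := by
  have hρ := Lp.stronglyMeasurable ρ
  refine Integrable.sub ⟨(hρ.integral_kernel (κ := Λs)).aestronglyMeasurable, ?_⟩ ?_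
  · refine lt_of_le_of_lt (lintegral_mono fun y => enorm_integral_le_lintegral_enorm _) ?_
    exact (h.lintegral_enorm_le hM hρ.measurable).trans_lt
      (ENNReal.mul_lt_top ENNReal.coe_lt_top (L1.integrable_coeFn ρ).2)
  · refine (L1.integrable_coeFn ρ).bdd_mul (c := (M : ℝ))
      (Λ.measurable_coe MeasurableSet.univ).ennreal_toReal.aestronglyMeasurable ?_
    refine Eventually.of_forall fun x => ?_
    rw [Real.norm_of_nonneg measureReal_nonneg]
    exact ENNReal.toReal_le_of_le_ofReal M.2 (by simpa using hM x)

/-- The adjoint jump generator `A*ρ = Λ*ρ - Λ(·, X) ρ` on `L¹(ν)`, for a bounded kernel `Λ`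
with adjoint kernel `Λs`. -/
def adjointJumpGenerator (h : IsAdjointKernel ν Λ Λs)
    (hM : ∃ M : ℝ≥0, ∀ x, Λ x Set.univ ≤ M) : Lp ℝ 1 ν →ₗ[ℝ] Lp ℝ 1 ν where
  toFun ρ := (h.integrable_adjointJumpFun hM.choose_spec ρ).toL1 _
  map_add' ρ σ := by
    rw [← Integrable.toL1_add, Integrable.toL1_eq_toL1_iff]
    have hae := Lp.coeFn_add ρ σ
    filter_upwards [hae, h.ae_ae hae, h.ae_integrable hM.choose_spec ρ,
      h.ae_integrable hM.choose_spec σ] with x h1 h2 h3 h4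
    simp only [adjointJumpFun, Pi.add_apply] at *
    rw [integral_congr_ae h2, h1, integral_add h3 h4]
    ring
  map_smul' c ρ := by
    rw [RingHom.id_apply, ← Integrable.toL1_smul, Integrable.toL1_eq_toL1_iff]
    have hae := Lp.coeFn_smul c ρ
    filter_upwards [hae, h.ae_ae hae] with x h1 h2
    simp only [adjointJumpFun, Pi.smul_apply, smul_eq_mul] at *
    rw [integral_congr_ae h2, h1, integral_const_mul]
    ring

end AdjointJump

/-! ### Empirical measures and empirical jump kernels -/

/-- The empirical measure `(1/n) ∑ δ_{z_i}` of `n` particles (used for `n ≥ 1`). -/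
def empiricalMeasure {X : Type*} [MeasurableSpace X] {n : ℕ} (z : Fin n → X) : Measure X :=
  (n : ℝ≥0∞)⁻¹ • ∑ i, Measure.dirac (z i)

theorem isProbabilityMeasure_empiricalMeasure {X : Type*} [MeasurableSpace X] {n : ℕ}
    (hn : 1 ≤ n) (z : Fin n → X) : IsProbabilityMeasure (empiricalMeasure z) := by
  refine ⟨?_⟩
  simp only [empiricalMeasure, Measure.smul_apply, Measure.finsetSum_apply, measure_univ,
    Finset.sum_const, Finset.card_univ, Fintype.card_fin, smul_eq_mul, nsmul_eq_mul, mul_one]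
  exact ENNReal.inv_mul_cancel (by simpa using by omega) (ENNReal.natCast_ne_top n)

/-- The set of all empirical measures of `n` particles; for a system of `N = n + 1` particles these
are the empirical measures of `N - 1` particles. -/
def empiricalMeasures (X : Type*) [MeasurableSpace X] (n : ℕ) : Set (Measure X) :=
  Set.range (empiricalMeasure : (Fin n → X) → Measure X)

/-- The empirical measure of a configuration, as an element of `empiricalMeasures`. -/
def toEmpirical {X : Type*} [MeasurableSpace X] {n : ℕ} (z : Fin n → X) : empiricalMeasures X n :=
  ⟨empiricalMeasure z, z, rfl⟩

/-- An empirical jump kernel of an `(n + 1)`-particle system: it assigns to each empirical measure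
`μ` of `n` particles a bounded Markov jump kernel `Λ(μ)` (no mass at the starting point), and
`Λ(x, E; μ(z))` is measurable in `(x, z)`, so that the dynamics of the particles in the mean field
of the others is given by a kernel. -/
structure EmpiricalJumpKernel (X : Type*) [MeasurableSpace X] (n : ℕ) where
  kernel : empiricalMeasures X n → Kernel X X
  bounded : ∀ μ, ∃ M : ℝ≥0, ∀ x, kernel μ x Set.univ ≤ M
  no_self_jump : ∀ μ x, kernel μ x {x} = 0
  measurable : ∀ E, MeasurableSet E →
    Measurable fun p : X × (Fin n → X) => kernel (toEmpirical p.2) p.1 E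

/-- Bounded intensity, uniformly over the empirical measures, and each `Λ(μ)` has the
adjoint kernel `Λs(μ)`. -/
structure BoundedIntensity {X : Type*} [MeasurableSpace X] {n : ℕ} (ν : Measure X)
    (Λ : EmpiricalJumpKernel X n) (Λs : empiricalMeasures X n → Kernel X X) : Prop where
  bound : ∃ M : ℝ≥0, ∀ μ x, Λ.kernel μ x Set.univ ≤ M
  adjoint : ∀ μ, IsAdjointKernel ν (Λ.kernel μ) (Λs μ)

/-! ### The adjoint generator of the `N`-particle system, `N = n + 1` -/

section NParticle

variable {X : Type*} [MeasurableSpace X]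

/-- The product measure `ν^{⊗N}`. -/
abbrev prodMeasure (ν : Measure X) (N : ℕ) : Measure (Fin N → X) := Measure.pi fun _ => ν

/-- The tensor product `f₁ ⊗ ⋯ ⊗ f_N ∈ L¹(ν^{⊗N})`. -/
def tensor (ν : Measure X) [IsFiniteMeasure ν] {N : ℕ} (f : Fin N → Lp ℝ 1 ν) :
    Lp ℝ 1 (prodMeasure ν N) :=
  (Integrable.fintype_prod (μ := fun _ => ν) fun i => L1.integrable_coeFn (f i)).toL1
    (fun x => ∏ i, f i (x i))

/-- The operator `I ⊗ ⋯ ⊗ K ⊗ ⋯ ⊗ I` on `L¹(ν^{⊗N})`, with `K` acting on the `k`-th particle: its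
graph is the closure of the span of the pairs
`(f₁ ⊗ ⋯ ⊗ f_N, f₁ ⊗ ⋯ ⊗ K f_k ⊗ ⋯ ⊗ f_N)` with `f_k` in the domain of `K`.
(For a generator `K` this closed subspace is the graph of an operator.) -/
def singleParticle (ν : Measure X) [IsFiniteMeasure ν] {N : ℕ} (K : Lp ℝ 1 ν →ₗ.[ℝ] Lp ℝ 1 ν)
    (k : Fin N) : Lp ℝ 1 (prodMeasure ν N) →ₗ.[ℝ] Lp ℝ 1 (prodMeasure ν N) :=
  (Submodule.span ℝ {p | ∃ (f : Fin N → Lp ℝ 1 ν) (g : Lp ℝ 1 ν), (f k, g) ∈ K.graph ∧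
    p = (tensor ν f, tensor ν (Function.update f k g))}).topologicalClosure.toLinearPMap

theorem ae_slice (ν : Measure X) [IsFiniteMeasure ν] {n : ℕ} (k : Fin (n + 1))
    {p : (Fin (n + 1) → X) → Prop} (hp : ∀ᵐ x ∂(prodMeasure ν (n + 1)), p x) :
    ∀ᵐ z ∂(prodMeasure ν n), ∀ᵐ s ∂ν, p (k.insertNth s z) := by
  have h1 := (measurePreserving_piFinSuccAbove (fun _ : Fin (n + 1) => ν) k).symm
  have h2 := h1.quasiMeasurePreserving.ae hp
  have h3 := (Measure.measurePreserving_swap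
    (μ := prodMeasure ν n) (ν := ν)).quasiMeasurePreserving.ae h2
  exact Measure.ae_ae_of_ae_prod h3

/-- `f ∈ L¹(ν)` is the slice `ρ(·, z)` in the `k`-th coordinate of `ρ ∈ L¹(ν^{⊗(n+1)})`, the other
coordinates being fixed to `z`. -/
def IsSlice (ν : Measure X) [IsFiniteMeasure ν] {n : ℕ} (k : Fin (n + 1))
    (ρ : Lp ℝ 1 (prodMeasure ν (n + 1))) (z : Fin n → X) (f : Lp ℝ 1 ν) : Prop :=
  f =ᵐ[ν] fun s => ρ (k.insertNth s z)

/-- The graph of the operator acting on the `k`-th coordinate by `B z`, where `z` is the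
configuration of the remaining particles: for almost every `z`, the slice
`η(·, z)` is `B z` applied to the slice `ρ(·, z)`. -/
def fiberwiseGraph (ν : Measure X) [IsFiniteMeasure ν] {n : ℕ}
    (B : (Fin n → X) → Lp ℝ 1 ν →ₗ[ℝ] Lp ℝ 1 ν) (k : Fin (n + 1)) :
    Submodule ℝ (Lp ℝ 1 (prodMeasure ν (n + 1)) × Lp ℝ 1 (prodMeasure ν (n + 1))) where
  carrier := {p | ∀ᵐ z ∂(prodMeasure ν n), ∃ f : Lp ℝ 1 ν,
    IsSlice ν k p.1 z f ∧ IsSlice ν k p.2 z (B z f)}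
  zero_mem' := by
    filter_upwards [ae_slice ν k (Lp.coeFn_zero ℝ 1 (prodMeasure ν (n + 1)))] with z hz
    refine ⟨0, ?_, ?_⟩ <;>
    · simp only [map_zero, IsSlice]
      filter_upwards [hz, Lp.coeFn_zero ℝ 1 ν] with s h1 h2
      rw [h2]
      exact h1.symm
  add_mem' := by
    intro p q hp hq
    filter_upwards [hp, hq, ae_slice ν k (Lp.coeFn_add p.1 q.1),
      ae_slice ν k (Lp.coeFn_add p.2 q.2)] with z ⟨f, hf, hf'⟩ ⟨g, hg, hg'⟩ h1 h2
    refine ⟨f + g, ?_, ?_⟩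
    · filter_upwards [hf, hg, h1, Lp.coeFn_add f g] with s a b c d
      rw [d, Prod.fst_add, c, Pi.add_apply, Pi.add_apply, a, b]
    · rw [map_add]
      filter_upwards [hf', hg', h2, Lp.coeFn_add (B z f) (B z g)] with s a b c d
      rw [d, Prod.snd_add, c, Pi.add_apply, Pi.add_apply, a, b]
  smul_mem' := by
    intro c p hp
    filter_upwards [hp, ae_slice ν k (Lp.coeFn_smul c p.1),
      ae_slice ν k (Lp.coeFn_smul c p.2)] with z ⟨f, hf, hf'⟩ h1 h2
    refine ⟨c • f, ?_, ?_⟩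
    · filter_upwards [hf, h1, Lp.coeFn_smul c f] with s a b d
      rw [d, Prod.smul_fst, b, Pi.smul_apply, Pi.smul_apply, a]
    · rw [map_smul]
      filter_upwards [hf', h2, Lp.coeFn_smul c (B z f)] with s a b d
      rw [d, Prod.smul_snd, b, Pi.smul_apply, Pi.smul_apply, a]

/-- `fiberwiseGraph` is the graph of an operator. -/
theorem fiberwiseGraph_snd_eq_zero (ν : Measure X) [IsFiniteMeasure ν] {n : ℕ}
    (B : (Fin n → X) → Lp ℝ 1 ν →ₗ[ℝ] Lp ℝ 1 ν) (k : Fin (n + 1))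
    (p : Lp ℝ 1 (prodMeasure ν (n + 1)) × Lp ℝ 1 (prodMeasure ν (n + 1)))
    (hp : p ∈ fiberwiseGraph ν B k) (h0 : p.1 = 0) : p.2 = 0 := by
  have hz : ∀ᵐ z ∂(prodMeasure ν n), ∀ᵐ s ∂ν, p.2 (k.insertNth s z) = 0 := by
    have h1 := Lp.coeFn_zero ℝ 1 (prodMeasure ν (n + 1))
    rw [← h0] at h1
    filter_upwards [hp, ae_slice ν k h1] with z ⟨f, hf, hg⟩ hz
    have hf0 : f = 0 := by
      rw [Lp.eq_zero_iff_ae_eq_zero]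
      exact hf.trans hz
    rw [hf0, map_zero] at hg
    exact hg.symm.trans (Lp.coeFn_zero ℝ 1 ν)
  have e := measurePreserving_piFinSuccAbove (fun _ : Fin (n + 1) => ν) k
  have hm : MeasurableSet {x : Fin (n + 1) → X | p.2 x = 0} :=
    (Lp.stronglyMeasurable p.2).measurable (measurableSet_singleton 0)
  have hm' : MeasurableSet {q : (Fin n → X) × X | p.2 (k.insertNth q.2 q.1) = 0} :=
    ((MeasurableEquiv.piFinSuccAbove (fun _ : Fin (n + 1) => X) k).symm.measurable.comp
      measurable_swap) hm
  have h1 := (Measure.ae_prod_iff_ae_ae hm').2 hz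
  have h2 := (Measure.measurePreserving_swap
    (μ := ν) (ν := prodMeasure ν n)).quasiMeasurePreserving.ae h1
  have h3 := e.quasiMeasurePreserving.ae h2
  rw [Lp.eq_zero_iff_ae_eq_zero]
  filter_upwards [h3] with x hx
  have hx' : (k.insertNth (x k) (k.removeNth x) : Fin (n + 1) → X) = x :=
    Fin.insertNth_self_removeNth k x
  rw [← hx']
  exact hx

/-- The operator acting on the `k`-th coordinate by `B z`, where `z` is the configuration of the
remaining particles. -/
def fiberwise (ν : Measure X) [IsFiniteMeasure ν] {n : ℕ}
    (B : (Fin n → X) → Lp ℝ 1 ν →ₗ[ℝ] Lp ℝ 1 ν) (k : Fin (n + 1)) :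
    Lp ℝ 1 (prodMeasure ν (n + 1)) →ₗ.[ℝ] Lp ℝ 1 (prodMeasure ν (n + 1)) :=
  (fiberwiseGraph ν B k).toLinearPMap

/-- The jump part `A^{*(k)}`: for almost every configuration `z` of the other particles, the adjoint
jump generator `A*(μ(z))` is applied to the slice `ρ(·, z)` in the `k`-th coordinate. -/
def jumpParticle (ν : Measure X) [IsFiniteMeasure ν] {n : ℕ} {Λ : EmpiricalJumpKernel X n}
    {Λs : empiricalMeasures X n → Kernel X X} (h : BoundedIntensity ν Λ Λs) (k : Fin (n + 1)) :
    Lp ℝ 1 (prodMeasure ν (n + 1)) →ₗ.[ℝ] Lp ℝ 1 (prodMeasure ν (n + 1)) :=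
  fiberwise ν (fun z => adjointJumpGenerator (h.adjoint (toEmpirical z))
    (Λ.bounded (toEmpirical z))) k

/-- The adjoint generator `L_N* = ∑_k (K^{*(k)} + A^{*(k)})` of the `N`-particle system,
`N = n + 1`: the closure of the sum of the operators, which is defined on the intersection of their
domains. -/
def nParticleGenerator (ν : Measure X) [IsFiniteMeasure ν] {n : ℕ}
    (K : Lp ℝ 1 ν →ₗ.[ℝ] Lp ℝ 1 ν) {Λ : EmpiricalJumpKernel X n}
    {Λs : empiricalMeasures X n → Kernel X X} (h : BoundedIntensity ν Λ Λs) :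
    Lp ℝ 1 (prodMeasure ν (n + 1)) →ₗ.[ℝ] Lp ℝ 1 (prodMeasure ν (n + 1)) :=
  (∑ k : Fin (n + 1), (singleParticle ν K k + jumpParticle ν h k)).closure

end NParticle

end MeanFieldJump

end

noncomputable section

namespace MeanFieldJump

/-! ### Strongly continuous semigroups -/

section Semigroup

variable {E : Type*} [NormedAddCommGroup E] [NormedSpace ℝ E] {S T : ℝ≥0 → E →L[ℝ] E}

/-! Without jumps the particles are independent. If `K` generates `S`, then `S t` acting in the
`k`-th coordinate is an adjoint Markov semigroup on `L¹(ν^{⊗N})`; these semigroups commute, and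
their product `P` is again adjoint Markov (`exists_coordinate`, `exists_prod`). Tensor products of
functions in the domain of `K` span a dense subspace that `P` leaves invariant, hence a core of the
generator of `P` (`genGraph_le_closure`, `tensorCore_isCore`), and on this core the generator is `∑
K^{*(k)}`.

The jump part `A = ∑ A^{*(k)}` is bounded because the intensities are uniformly bounded; its values
have mass zero, and `A + c` is positive for large `c` (`exists_jump_operator`). Adding a bounded
operator to a generator gives a generator with the same domain. Solving the Volterra equation for `A
+ c` by a Neumann series with positive terms shows that the perturbed semigroup `U` is positive, and
it conserves mass because all values of its generator have integral zero (`exists_perturbation`).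
The sum in the theorem is contained in the generator of `U`, which is closed, and it contains the
core of `P` shifted by `A`; so its closure is the generator of `U`.

The delicate point is that `A^{*(k)}` is defined on all of `L¹`. The adjoint kernels are given for
each `μ` separately, with no measurability in the configuration. The operator is therefore handled
through its graph over slices, which is closed and bounded (`isClosed_fiberwiseGraph`). Its domain
contains every indicator function, because the law after a jump from a set is a kernel in the
configuration, and its Radon-Nikodym derivative is a jointly measurable version of the gain term
(`indicatorL1_mem_domain`). -/

/-- `x` is in the domain of the infinitesimal generator of `S`, which maps it to `y`. -/
def IsGen (S : ℝ≥0 → E →L[ℝ] E) (x y : E) : Prop :=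
  Tendsto (fun h : ℝ≥0 => (h : ℝ)⁻¹ • (S h x - x)) (𝓝[>] 0) (𝓝 y)

/-- The graph of the infinitesimal generator. -/
def genGraph (S : ℝ≥0 → E →L[ℝ] E) : Submodule ℝ (E × E) where
  carrier := {p | IsGen S p.1 p.2}
  zero_mem' := by simp [IsGen]
  add_mem' := by
    intro p q hp hq
    refine (Tendsto.add hp hq).congr fun h => ?_
    simp only [Prod.fst_add, map_add, ← smul_add]
    congr 1
    abel
  smul_mem' := by
    intro c p hp
    refine (Tendsto.const_smul hp c).congr fun h => ?_
    simp only [Prod.smul_fst, map_smul, ← smul_sub]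
    rw [smul_comm]

theorem mem_genGraph {p : E × E} : p ∈ genGraph S ↔ IsGen S p.1 p.2 := Iff.rfl

theorem IsGen.congr {x y y' : E} (h : IsGen S x y) (hy : y = y') : IsGen S x y' := hy ▸ h

theorem IsGen.map (hS : IsC0Semigroup S) {x y : E} (h : IsGen S x y) (t : ℝ≥0) :
    IsGen S (S t x) (S t y) := by
  refine (((S t).continuous.tendsto y).comp h).congr fun r => ?_
  simp only [Function.comp_apply, map_smul, map_sub]
  rw [← ContinuousLinearMap.comp_apply, ← hS.map_add, add_comm, hS.map_add,
    ContinuousLinearMap.comp_apply]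

theorem tendsto_toNNReal_sub (t : ℝ) :
    Tendsto (fun s : ℝ => (s - t).toNNReal) (𝓝[>] t) (𝓝[>] 0) := by
  refine tendsto_nhdsWithin_iff.2 ⟨?_, ?_⟩
  · have : Continuous fun s : ℝ => (s - t).toNNReal := by fun_prop
    simpa using (this.tendsto t).mono_left nhdsWithin_le_nhds
  · filter_upwards [self_mem_nhdsWithin] with s hs
    simpa using hs

theorem tendsto_coe_nhdsGT_zero : Tendsto (fun h : ℝ≥0 => (h : ℝ)) (𝓝[>] 0) (𝓝[>] 0) := by
  refine tendsto_nhdsWithin_iff.2 ⟨?_, ?_⟩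
  · exact (NNReal.continuous_coe.tendsto' 0 0 rfl).mono_left nhdsWithin_le_nhds
  · filter_upwards [self_mem_nhdsWithin] with s hs
    exact_mod_cast hs

/-- Makes right limits at zero in `ℝ≥0` unique, so that a generator is single-valued. -/
instance neBot_nhdsGT_zero : (𝓝[>] (0 : ℝ≥0)).NeBot :=
  (by simpa using tendsto_toNNReal_sub 0 :
    Tendsto (fun s : ℝ => s.toNNReal) (𝓝[>] 0) (𝓝[>] 0)).neBot

theorem IsGen.unique {x y y' : E} (h : IsGen S x y) (h' : IsGen S x y') : y = y' :=
  tendsto_nhds_unique h h'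

theorem IsC0Semigroup.hasDerivWithinAt (hS : IsC0Semigroup S) {x y : E} (h : IsGen S x y) {t : ℝ}
    (ht : 0 ≤ t) :
    HasDerivWithinAt (fun s : ℝ => S s.toNNReal x) (S t.toNNReal y) (Set.Ioi t) t := by
  rw [hasDerivWithinAt_iff_tendsto_slope' (by simp)]
  refine (((S t.toNNReal).continuous.tendsto y).comp (h.comp (tendsto_toNNReal_sub t))).congr' ?_
  filter_upwards [self_mem_nhdsWithin] with s hs
  have hs' : t < s := hs
  have e : s.toNNReal = t.toNNReal + (s - t).toNNReal := by
    rw [← Real.toNNReal_add ht (by linarith)]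
    congr 1
    ring
  simp only [Function.comp_apply, slope, vsub_eq_sub, map_smul, map_sub]
  rw [e, hS.map_add, Real.coe_toNNReal _ (by linarith)]
  rfl

/-- A jointly continuous action from strong continuity and a uniform bound. -/
theorem continuous_uncurry_of_bound {C : ℝ} (hb : ∀ t x, ‖S t x‖ ≤ C * ‖x‖)
    (hc : ∀ x, Continuous fun t => S t x) : Continuous fun p : ℝ≥0 × E => S p.1 p.2 := by
  rw [continuous_iff_continuousAt]
  rintro ⟨t, x⟩
  have h1 : Tendsto (fun p : ℝ≥0 × E => S p.1 x) (𝓝 (t, x)) (𝓝 (S t x)) :=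
    ((hc x).comp continuous_fst).tendsto (t, x)
  have h2 : Tendsto (fun p : ℝ≥0 × E => S p.1 (p.2 - x)) (𝓝 (t, x)) (𝓝 0) := by
    refine squeeze_zero_norm (fun p => hb _ _) ?_
    have : Continuous fun p : ℝ≥0 × E => C * ‖p.2 - x‖ := by fun_prop
    simpa using this.tendsto (t, x)
  have := h1.add h2
  rw [add_zero] at this
  refine this.congr fun p => ?_
  simp

theorem IsC0Semigroup.continuous (hS : IsC0Semigroup S) (hb : ∀ t x, ‖S t x‖ ≤ ‖x‖) (x : E) :
    Continuous fun t => S t x := by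
  -- Subtraction is truncated, so `s - t + (t - s)` is `|s - t|`.
  have key : ∀ s t : ℝ≥0, ‖S s x - S t x‖ ≤ ‖S (s - t + (t - s)) x - x‖ := by
    intro s t
    rcases le_total t s with h | h
    · have e : s = t + (s - t) := (add_tsub_cancel_of_le h).symm
      rw [tsub_eq_zero_of_le h, add_zero]
      conv_lhs => rw [e, hS.map_add]
      rw [ContinuousLinearMap.comp_apply, ← map_sub]
      exact hb _ _
    · have e : t = s + (t - s) := (add_tsub_cancel_of_le h).symm
      rw [tsub_eq_zero_of_le h, zero_add, norm_sub_rev]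
      conv_lhs => rw [e, hS.map_add]
      rw [ContinuousLinearMap.comp_apply, ← map_sub]
      exact hb _ _
  rw [continuous_iff_continuousAt]
  intro t
  rw [ContinuousAt, tendsto_iff_norm_sub_tendsto_zero]
  refine squeeze_zero (fun _ => norm_nonneg _) (fun s => key s t) ?_
  have h1 : Tendsto (fun s : ℝ≥0 => s - t + (t - s)) (𝓝 t) (𝓝 0) := by
    have : Continuous fun s : ℝ≥0 => s - t + (t - s) := by fun_prop
    simpa using this.tendsto t
  simpa using ((hS.tendsto_zero x).comp h1).sub_const x |>.norm

theorem continuous_toNNReal_orbit (hc : ∀ x, Continuous fun t => S t x) (x : E) :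
    Continuous fun s : ℝ => S s.toNNReal x :=
  (hc x).comp continuous_real_toNNReal

/-- The product of two commuting contraction semigroups. -/
theorem IsC0Semigroup.comp (hS : IsC0Semigroup S) (hb : ∀ t x, ‖S t x‖ ≤ ‖x‖)
    (hT : IsC0Semigroup T) (hcomm : ∀ s t x, S s (T t x) = T t (S s x)) :
    IsC0Semigroup fun t => (S t).comp (T t) where
  map_zero := by simp [hS.map_zero, hT.map_zero]
  map_add s t := by
    ext x
    simp only [hS.map_add, hT.map_add, ContinuousLinearMap.comp_apply, hcomm]
  tendsto_zero x := by
    have := (continuous_uncurry_of_bound (C := 1) (by simpa using hb)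
      (hS.continuous hb)).tendsto (0, x)
    simp only [hS.map_zero, ContinuousLinearMap.id_apply] at this
    exact this.comp (tendsto_id.prodMk_nhds (hT.tendsto_zero x))

/-- Split `S T x - x = S (T x - x) + (S x - x)`; joint continuity of the action gives the limit of
the first term. -/
theorem IsGen.comp (hS : IsC0Semigroup S) (hb : ∀ t x, ‖S t x‖ ≤ ‖x‖) {x y z : E}
    (h1 : IsGen S x y) (h2 : IsGen T x z) : IsGen (fun t => (S t).comp (T t)) x (z + y) := by
  have := (continuous_uncurry_of_bound (C := 1) (by simpa using hb)
    (hS.continuous hb)).tendsto (0, z)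
  simp only [hS.map_zero, ContinuousLinearMap.id_apply] at this
  have h3 := this.comp ((tendsto_id.mono_left nhdsWithin_le_nhds).prodMk_nhds h2)
  refine (h3.add h1).congr fun h => ?_
  simp only [Function.comp_apply, id, map_smul, map_sub, ← smul_add, ContinuousLinearMap.comp_apply]
  congr 1
  abel

/-- Exponential rescaling of a semigroup. -/
def rescale (c : ℝ) (S : ℝ≥0 → E →L[ℝ] E) (t : ℝ≥0) : E →L[ℝ] E := Real.exp (c * t) • S t

theorem IsC0Semigroup.rescaled (hS : IsC0Semigroup S) (c : ℝ) : IsC0Semigroup (rescale c S) where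
  map_zero := by simp [rescale, hS.map_zero]
  map_add s t := by
    ext x
    simp only [rescale, hS.map_add, NNReal.coe_add, mul_add, Real.exp_add,
      ContinuousLinearMap.comp_apply, smul_apply, map_smul, smul_smul]
    rw [mul_comm]
  tendsto_zero x := by
    have h : Tendsto (fun t : ℝ≥0 => Real.exp (c * t)) (𝓝 0) (𝓝 1) := by
      have : Continuous fun t : ℝ≥0 => Real.exp (c * t) := by fun_prop
      exact this.tendsto' _ _ (by simp)
    simpa [rescale] using h.smul (hS.tendsto_zero x)

theorem IsGen.rescaled {x y : E} (h : IsGen S x y) (c : ℝ) :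
    IsGen (rescale c S) x (y + c • x) := by
  have h1 : Tendsto (fun t : ℝ≥0 => Real.exp (c * t)) (𝓝[>] 0) (𝓝 1) := by
    have : Continuous fun t : ℝ≥0 => Real.exp (c * t) := by fun_prop
    exact (this.tendsto' _ _ (by simp)).mono_left nhdsWithin_le_nhds
  have h2 : Tendsto (fun t : ℝ≥0 => (t : ℝ)⁻¹ • (Real.exp (c * t) - 1)) (𝓝[>] 0) (𝓝 c) := by
    have : HasDerivAt (fun t : ℝ => Real.exp (c * t)) c 0 := by
      simpa using ((hasDerivAt_id (0 : ℝ)).const_mul c).exp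
    simpa [Function.comp_def] using this.tendsto_slope_zero_right.comp tendsto_coe_nhdsGT_zero
  have := (h1.smul h).add (h2.smul_const x)
  rw [one_smul] at this
  refine this.congr fun t => ?_
  simp only [rescale, smul_apply, smul_sub, sub_smul, smul_smul,
    smul_eq_mul, mul_sub, mul_one]
  rw [mul_comm (Real.exp _)]
  abel

theorem continuous_integral_orbit (hb : ∀ t x, ‖S t x‖ ≤ ‖x‖)
    (hc : ∀ x, Continuous fun t => S t x) (t : ℝ) :
    Continuous fun x => ∫ s in (0 : ℝ)..t, S s.toNNReal x := by
  refine intervalIntegral.continuous_parametric_intervalIntegral_of_continuous'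
    (f := fun x (s : ℝ) => S s.toNNReal x) ?_ 0 t
  exact (continuous_uncurry_of_bound (C := 1) (by simpa using hb) hc).comp
    ((continuous_real_toNNReal.comp continuous_snd).prodMk continuous_fst)

/-! ### Integrals of orbits, closed generators and cores. -/

variable [CompleteSpace E]

theorem IsC0Semigroup.integral_eq_sub (hS : IsC0Semigroup S)
    (hc : ∀ x, Continuous fun t => S t x) {x y : E} (h : IsGen S x y) {t : ℝ} (ht : 0 ≤ t) :
    ∫ s in (0 : ℝ)..t, S s.toNNReal y = S t.toNNReal x - x := by
  rw [intervalIntegral.integral_eq_sub_of_hasDeriv_right_of_le ht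
    (f := fun s : ℝ => S s.toNNReal x) (continuous_toNNReal_orbit hc x).continuousOn
    (fun s hs => hS.hasDerivWithinAt h hs.1.le)
    ((continuous_toNNReal_orbit hc y).intervalIntegrable _ _)]
  simp [hS.map_zero]

theorem tendsto_average {F : Type*} [NormedAddCommGroup F] [NormedSpace ℝ F] [CompleteSpace F]
    {f : ℝ → F} (hf : Continuous f) (t : ℝ) :
    Tendsto (fun h : ℝ≥0 => (h : ℝ)⁻¹ • ((∫ s in (0 : ℝ)..(t + h), f s) - ∫ s in (0 : ℝ)..t, f s))
      (𝓝[>] 0) (𝓝 (f t)) := by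
  have h := (intervalIntegral.integral_hasDerivAt_right (hf.intervalIntegrable 0 t)
    (hf.stronglyMeasurableAtFilter _ _) hf.continuousAt).tendsto_slope_zero_right
  exact h.comp tendsto_coe_nhdsGT_zero

theorem tendsto_average_zero {F : Type*} [NormedAddCommGroup F] [NormedSpace ℝ F] [CompleteSpace F]
    {f : ℝ → F} (hf : Continuous f) :
    Tendsto (fun h : ℝ≥0 => (h : ℝ)⁻¹ • ∫ s in (0 : ℝ)..h, f s) (𝓝[>] 0) (𝓝 (f 0)) := by
  simpa using tendsto_average hf 0

/-- With `integral_eq_sub`, this describes the generator by identities that are continuous in `(x,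
y)`; its graph is therefore closed. -/
theorem IsC0Semigroup.isGen_of_integral_eq (hS : IsC0Semigroup S)
    (hc : ∀ x, Continuous fun t => S t x) {x y : E}
    (h : ∀ t : ℝ≥0, ∫ s in (0 : ℝ)..t, S s.toNNReal y = S t x - x) : IsGen S x y := by
  have := tendsto_average_zero (continuous_toNNReal_orbit hc y)
  simp only [Real.toNNReal_zero, hS.map_zero, ContinuousLinearMap.id_apply] at this
  exact this.congr fun t => by rw [h]

/-- Applying `S h - 1` to the integral over `[0, t]` leaves the integral over `[t, t + h]` minus
that over `[0, h]`; divided by `h`, these tend to `S t x` and `x`. -/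
theorem IsC0Semigroup.isGen_integral (hS : IsC0Semigroup S)
    (hc : ∀ x, Continuous fun t => S t x) (x : E) (t : ℝ≥0) :
    IsGen S (∫ s in (0 : ℝ)..t, S s.toNNReal x) (S t x - x) := by
  have hcx := continuous_toNNReal_orbit hc x
  have h1 := tendsto_average hcx t
  have h2 := tendsto_average_zero hcx
  simp only [Real.toNNReal_zero, hS.map_zero, ContinuousLinearMap.id_apply,
    Real.toNNReal_coe] at h1 h2
  refine (h1.sub h2).congr fun h => ?_
  rw [← smul_sub]
  congr 1
  rw [← ContinuousLinearMap.intervalIntegral_comp_comm _ (hcx.intervalIntegrable _ _)]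
  have e : ∫ s in (0 : ℝ)..t, S h (S s.toNNReal x) = ∫ s in (h : ℝ)..(t + h), S s.toNNReal x := by
    have := intervalIntegral.integral_comp_add_right (a := 0) (b := (t : ℝ))
      (fun s => S s.toNNReal x) (h : ℝ)
    rw [zero_add] at this
    rw [← this]
    refine intervalIntegral.integral_congr fun s hs => ?_
    rw [Set.uIcc_of_le (NNReal.coe_nonneg t)] at hs
    have : (s + h).toNNReal = h + s.toNNReal := by
      rw [Real.toNNReal_add hs.1 (NNReal.coe_nonneg h), Real.toNNReal_coe, add_comm]
    simp only [this, hS.map_add, ContinuousLinearMap.comp_apply]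
  rw [e, ← intervalIntegral.integral_interval_sub_left (hcx.intervalIntegrable 0 (t + h))
    (hcx.intervalIntegrable 0 h)]
  abel

theorem IsC0Semigroup.dense_domain (hS : IsC0Semigroup S)
    (hc : ∀ x, Continuous fun t => S t x) : Dense {x | ∃ y, IsGen S x y} := by
  intro x
  have h := tendsto_average_zero (continuous_toNNReal_orbit hc x)
  simp only [Real.toNNReal_zero, hS.map_zero, ContinuousLinearMap.id_apply] at h
  refine mem_closure_of_tendsto h (Eventually.of_forall fun t => ?_)
  have h3 : ((∫ s in (0 : ℝ)..t, S s.toNNReal x, S t x - x) : E × E) ∈ genGraph S :=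
    hS.isGen_integral hc x t
  exact ⟨(t : ℝ)⁻¹ • (S t x - x), (genGraph S).smul_mem (t : ℝ)⁻¹ h3⟩

theorem IsC0Semigroup.isClosed_genGraph (hS : IsC0Semigroup S) (hb : ∀ t x, ‖S t x‖ ≤ ‖x‖) :
    IsClosed (genGraph S : Set (E × E)) := by
  have hc := hS.continuous hb
  have e : (genGraph S : Set (E × E)) =
      ⋂ t : ℝ≥0, {p : E × E | ∫ s in (0 : ℝ)..t, S s.toNNReal p.2 = S t p.1 - p.1} := by
    ext p
    simp only [SetLike.mem_coe, mem_genGraph, Set.mem_iInter, Set.mem_ofPred_eq]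
    exact ⟨fun h t => by simpa using hS.integral_eq_sub hc h t.2, hS.isGen_of_integral_eq hc⟩
  rw [e]
  refine isClosed_iInter fun t => isClosed_eq
    ((continuous_integral_orbit hb hc t).comp continuous_snd) (by fun_prop)

/-- An invariant subspace of the domain of the generator that is dense in the space is a core. -/
theorem IsC0Semigroup.genGraph_le_closure (hS : IsC0Semigroup S) (hb : ∀ t x, ‖S t x‖ ≤ ‖x‖)
    (D : Submodule ℝ (E × E)) (hD : D ≤ genGraph S)
    (hinv : ∀ t, ∀ p ∈ D, (S t p.1, S t p.2) ∈ D) (hdense : Dense (Prod.fst '' (D : Set (E × E)))) :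
    genGraph S ≤ D.topologicalClosure := by
  have hc := hS.continuous hb
  have hcl : IsClosed (D.topologicalClosure : Set (E × E)) := D.isClosed_topologicalClosure
  have hcomp : CompleteSpace D.topologicalClosure := hcl.completeSpace_coe
  -- This pair depends continuously on `x`, so by density it suffices to take `x` among the first
  -- components of `D`.
  have key : ∀ (t : ℝ≥0) (x : E),
      ((∫ s in (0 : ℝ)..t, S s.toNNReal x, S t x - x) : E × E) ∈ D.topologicalClosure := by
    intro t x
    have hΦ : Continuous fun x => ((∫ s in (0 : ℝ)..t, S s.toNNReal x, S t x - x) : E × E) :=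
      (continuous_integral_orbit hb hc t).prodMk (by fun_prop)
    refine closure_minimal ?_ (hcl.preimage hΦ) (hdense x)
    · rintro _ ⟨p, hp, rfl⟩
      rw [Set.mem_preimage]
      -- By invariance the orbit of `p` stays in `D`. Integrating it as a function with values in
      -- the complete space `D.topologicalClosure` keeps the integral there.
      let f : ℝ → D.topologicalClosure := fun s =>
        ⟨(S s.toNNReal p.1, S s.toNNReal p.2), D.le_topologicalClosure (hinv _ p hp)⟩
      have hf : Continuous f := ((continuous_toNNReal_orbit hc p.1).prodMk
        (continuous_toNNReal_orbit hc p.2)).subtype_mk _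
      have hint := hf.intervalIntegrable (μ := volume) 0 t
      have h1 := ((ContinuousLinearMap.fst ℝ E E).comp
        D.topologicalClosure.subtypeL).intervalIntegral_comp_comm hint
      have h2 := ((ContinuousLinearMap.snd ℝ E E).comp
        D.topologicalClosure.subtypeL).intervalIntegral_comp_comm hint
      have h3 : ∫ s in (0 : ℝ)..t, S s.toNNReal p.2 = S t p.1 - p.1 := by
        simpa using hS.integral_eq_sub hc (hD hp) t.2
      have e : ((∫ s in (0 : ℝ)..t, S s.toNNReal p.1, S t p.1 - p.1) : E × E) =
          (∫ s in (0 : ℝ)..t, f s : D.topologicalClosure) := by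
        rw [← h3]
        exact Prod.ext h1 h2
      rw [e]
      exact SetLike.coe_mem _
  rintro ⟨x, y⟩ hxy
  -- For `(x, y)` in the graph, the pairs of `key` divided by `t` converge to `(x, y)` as `t → 0`.
  have h1 := tendsto_average_zero (continuous_toNNReal_orbit hc x)
  simp only [Real.toNNReal_zero, hS.map_zero, ContinuousLinearMap.id_apply] at h1
  exact hcl.mem_of_tendsto (h1.prodMk_nhds hxy) (Eventually.of_forall fun t =>
    D.topologicalClosure.smul_mem (t : ℝ)⁻¹ (key t x))

end Semigroup

/-! ### Bounded perturbations of contraction semigroups -/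

section Perturbation

open scoped BoundedContinuousFunction

variable {E : Type*} [NormedAddCommGroup E] [NormedSpace ℝ E] {V : ℝ≥0 → E →L[ℝ] E} {l : ℝ}

/-- A `C₀`-semigroup with exponential decay at rate `l > 0`. -/
structure IsDecayingSemigroup (V : ℝ≥0 → E →L[ℝ] E) (l : ℝ) : Prop extends IsC0Semigroup V where
  pos : 0 < l
  bound : ∀ t x, ‖V t x‖ ≤ Real.exp (-l * t) * ‖x‖

theorem IsC0Semigroup.isDecayingSemigroup_rescale {T : ℝ≥0 → E →L[ℝ] E} (hT : IsC0Semigroup T)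
    (hb : ∀ t x, ‖T t x‖ ≤ ‖x‖) (hl : 0 < l) : IsDecayingSemigroup (rescale (-l) T) l where
  toIsC0Semigroup := hT.rescaled _
  pos := hl
  bound t x := by
    simp only [rescale, smul_apply, norm_smul, Real.norm_eq_abs, Real.abs_exp]
    gcongr
    exact hb t x

namespace IsDecayingSemigroup

theorem norm_le (hV : IsDecayingSemigroup V l) (t : ℝ≥0) (x : E) : ‖V t x‖ ≤ ‖x‖ := by
  refine (hV.bound t x).trans (mul_le_of_le_one_left (norm_nonneg _) ?_)
  rw [Real.exp_le_one_iff]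
  have := hV.pos
  nlinarith [t.2]

theorem continuous (hV : IsDecayingSemigroup V l) (x : E) : Continuous fun t => V t x :=
  hV.toIsC0Semigroup.continuous hV.norm_le x

theorem continuous_integrand (hV : IsDecayingSemigroup V l) {g : ℝ≥0 → E} (hg : Continuous g) :
    Continuous (Function.uncurry fun t s : ℝ => V (t - s).toNNReal (g s.toNNReal)) := by
  refine (continuous_uncurry_of_bound (C := 1) (by simpa using hV.norm_le) hV.continuous).comp
    (Continuous.prodMk ?_ ?_)
  · fun_prop
  · exact hg.comp (continuous_real_toNNReal.comp continuous_snd)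

theorem continuous_integrand_right (hV : IsDecayingSemigroup V l) {g : ℝ≥0 → E}
    (hg : Continuous g) (t : ℝ) :
    Continuous fun s : ℝ => V (t - s).toNNReal (g s.toNNReal) :=
  (hV.continuous_integrand hg).comp (by fun_prop : Continuous fun s : ℝ => (t, s))

/-- The integral of `exp (-l (t - s))` over `[0, t]` is at most `1 / l` for every `t`. This is the
purpose of the decay: the Volterra equation can be solved on the whole half-line at once. -/
theorem norm_integral_le (hV : IsDecayingSemigroup V l) {g : ℝ≥0 → E} {C : ℝ}
    (hC : ∀ s, ‖g s‖ ≤ C) (t : ℝ≥0) :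
    ‖∫ s in (0 : ℝ)..t, V (t - s).toNNReal (g s.toNNReal)‖ ≤ C / l := by
  have hl := hV.pos
  have hC0 : 0 ≤ C := (norm_nonneg _).trans (hC 0)
  have hcont : Continuous fun s : ℝ => Real.exp (-l * (t - s)) * C := by fun_prop
  have h1 : ‖∫ s in (0 : ℝ)..t, V (t - s).toNNReal (g s.toNNReal)‖ ≤
      ∫ s in (0 : ℝ)..t, Real.exp (-l * (t - s)) * C := by
    refine intervalIntegral.norm_integral_le_of_norm_le t.2 (Eventually.of_forall fun s hs => ?_)
      (hcont.intervalIntegrable _ _)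
    refine (hV.bound _ _).trans ?_
    rw [Real.coe_toNNReal _ (by linarith [hs.2])]
    gcongr
    exact hC _
  have h2 : ∫ s in (0 : ℝ)..t, Real.exp (-l * (t - s)) * C =
      Real.exp (-l * (t - t)) * C / l - Real.exp (-l * (t - 0)) * C / l := by
    refine intervalIntegral.integral_eq_sub_of_hasDerivAt
      (f := fun s : ℝ => Real.exp (-l * (t - s)) * C / l) (fun s _ => ?_)
      (hcont.intervalIntegrable _ _)
    have := (((((hasDerivAt_id s).const_sub (t : ℝ)).const_mul (-l)).exp.mul_const C).div_const l)
    refine this.congr_deriv ?_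
    simp only [id]
    field_simp
  rw [h2] at h1
  refine h1.trans ?_
  have : 0 ≤ Real.exp (-l * (t - 0)) * C / l := by positivity
  simpa using this

/-! ### The Volterra equation of the perturbed semigroup. -/

/-- The orbits of the semigroup. -/
def orbit (hV : IsDecayingSemigroup V l) : E →L[ℝ] (ℝ≥0 →ᵇ E) :=
  LinearMap.mkContinuous
    { toFun := fun x => BoundedContinuousFunction.ofNormedAddCommGroup (fun t => V t x)
        (hV.continuous x) ‖x‖ fun t => hV.norm_le t x
      map_add' := fun x y => by ext t; simp
      map_smul' := fun c x => by ext t; simp } 1 fun x => by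
    rw [one_mul]
    exact BoundedContinuousFunction.norm_ofNormedAddCommGroup_le _ (norm_nonneg _) fun t => hV.norm_le t x

@[simp] theorem orbit_apply (hV : IsDecayingSemigroup V l) (x : E) (t : ℝ≥0) :
    hV.orbit x t = V t x := rfl

theorem norm_volterra_integral_le (hV : IsDecayingSemigroup V l) (B : E →L[ℝ] E) (u : ℝ≥0 →ᵇ E)
    (t : ℝ≥0) :
    ‖∫ s in (0 : ℝ)..t, V (t - s).toNNReal (B (u s.toNNReal))‖ ≤ ‖B‖ / l * ‖u‖ := by
  rw [div_mul_eq_mul_div]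
  exact hV.norm_integral_le (g := fun s => B (u s)) (fun s => (B.le_opNorm _).trans
    (mul_le_mul_of_nonneg_left (u.norm_coe_le_norm s) (norm_nonneg _))) t

/-- The Volterra operator `u ↦ ∫₀ᵗ V (t - s) (B (u s)) ds`. -/
def volterra (hV : IsDecayingSemigroup V l) (B : E →L[ℝ] E) : (ℝ≥0 →ᵇ E) →L[ℝ] (ℝ≥0 →ᵇ E) :=
  LinearMap.mkContinuous
    { toFun := fun u => BoundedContinuousFunction.ofNormedAddCommGroup
        (fun t : ℝ≥0 => ∫ s in (0 : ℝ)..t, V (t - s).toNNReal (B (u s.toNNReal)))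
        ((intervalIntegral.continuous_parametric_intervalIntegral_of_continuous
          (hV.continuous_integrand (B.continuous.comp u.continuous))
          continuous_id).comp NNReal.continuous_coe) (‖B‖ / l * ‖u‖) (hV.norm_volterra_integral_le B u)
      map_add' := fun u v => by
        ext t
        simp only [BoundedContinuousFunction.coe_ofNormedAddCommGroup,
          BoundedContinuousFunction.coe_add, Pi.add_apply, map_add]
        exact intervalIntegral.integral_add
          ((hV.continuous_integrand_right (B.continuous.comp u.continuous) _).intervalIntegrable _ _)
          ((hV.continuous_integrand_right (B.continuous.comp v.continuous) _).intervalIntegrable _ _)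
      map_smul' := fun c u => by
        ext t
        simp only [BoundedContinuousFunction.coe_ofNormedAddCommGroup,
          BoundedContinuousFunction.coe_smul, map_smul, RingHom.id_apply]
        exact intervalIntegral.integral_smul _ _ } (‖B‖ / l) fun u =>
    BoundedContinuousFunction.norm_ofNormedAddCommGroup_le _
      (mul_nonneg (div_nonneg (norm_nonneg _) hV.pos.le) (norm_nonneg _)) (hV.norm_volterra_integral_le B u)

theorem volterra_apply (hV : IsDecayingSemigroup V l) (B : E →L[ℝ] E) (u : ℝ≥0 →ᵇ E) (t : ℝ≥0) :
    hV.volterra B u t = ∫ s in (0 : ℝ)..t, V (t - s).toNNReal (B (u s.toNNReal)) := rfl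

/-- Ensures that the Neumann series in `solution` converges. -/
theorem norm_volterra_lt_one (hV : IsDecayingSemigroup V l) {B : E →L[ℝ] E} (hB : ‖B‖ < l) :
    ‖hV.volterra B‖ < 1 :=
  (ContinuousLinearMap.opNorm_le_bound _ (div_nonneg (norm_nonneg _) hV.pos.le) fun u =>
    BoundedContinuousFunction.norm_ofNormedAddCommGroup_le _
      (mul_nonneg (div_nonneg (norm_nonneg _) hV.pos.le) (norm_nonneg _))
      (hV.norm_volterra_integral_le B u)).trans_lt ((div_lt_one hV.pos).2 hB)

/-- The solution operator of the Volterra equation `u = f + ∫₀ᵗ V (t - s) (B (u s)) ds`. -/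
def solution (hV : IsDecayingSemigroup V l) (B : E →L[ℝ] E) : (ℝ≥0 →ᵇ E) →L[ℝ] (ℝ≥0 →ᵇ E) :=
  ∑' m : ℕ, hV.volterra B ^ m

/-- The semigroup generated by the sum of the generator of `V` and `B`. -/
def perturbed (hV : IsDecayingSemigroup V l) (B : E →L[ℝ] E) (t : ℝ≥0) : E →L[ℝ] E :=
  (BoundedContinuousFunction.evalCLM ℝ t).comp ((hV.solution B).comp hV.orbit)

theorem perturbed_apply (hV : IsDecayingSemigroup V l) (B : E →L[ℝ] E) (t : ℝ≥0) (x : E) :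
    hV.perturbed B t x = hV.solution B (hV.orbit x) t := rfl

theorem continuous_perturbed (hV : IsDecayingSemigroup V l) (B : E →L[ℝ] E) (x : E) :
    Continuous fun t => hV.perturbed B t x :=
  (hV.solution B (hV.orbit x)).continuous

variable [CompleteSpace E]

theorem solution_eq (hV : IsDecayingSemigroup V l) {B : E →L[ℝ] E} (hB : ‖B‖ < l)
    (f : ℝ≥0 →ᵇ E) : hV.solution B f = f + hV.volterra B (hV.solution B f) := by
  have h := DFunLike.congr_fun (mul_neg_geom_series _ (hV.norm_volterra_lt_one hB)) f
  simp only [mul_apply_eq_comp, sub_apply,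
    one_apply_eq_self] at h
  exact sub_eq_iff_eq_add.1 h

theorem eq_solution (hV : IsDecayingSemigroup V l) {B : E →L[ℝ] E} (hB : ‖B‖ < l)
    {f u : ℝ≥0 →ᵇ E} (hu : u = f + hV.volterra B u) : u = hV.solution B f := by
  have h := DFunLike.congr_fun (geom_series_mul_neg _ (hV.norm_volterra_lt_one hB)) u
  simp only [mul_apply_eq_comp, sub_apply,
    one_apply_eq_self] at h
  rw [sub_eq_of_eq_add hu] at h
  exact h.symm

theorem perturbed_eq (hV : IsDecayingSemigroup V l) {B : E →L[ℝ] E} (hB : ‖B‖ < l) (t : ℝ≥0)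
    (x : E) : hV.perturbed B t x =
      V t x + ∫ s in (0 : ℝ)..t, V (t - s).toNNReal (B (hV.perturbed B s.toNNReal x)) := by
  rw [perturbed_apply, hV.solution_eq hB]
  rfl

/-- The time shift of a solution solves the Volterra equation started from its value at time `s`:
the integral over `[0, s]` is absorbed into the initial value. Uniqueness of the solution gives the
semigroup law. -/
theorem perturbed_add (hV : IsDecayingSemigroup V l) {B : E →L[ℝ] E} (hB : ‖B‖ < l) (t s : ℝ≥0)
    (x : E) : hV.perturbed B (t + s) x = hV.perturbed B t (hV.perturbed B s x) := by
  let w := hV.solution B (hV.orbit x)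
  let u : ℝ≥0 →ᵇ E := w.compContinuous ⟨fun t => t + s, by fun_prop⟩
  suffices h : u = hV.orbit (w s) + hV.volterra B u from
    DFunLike.congr_fun (hV.eq_solution hB h) t
  have hg : Continuous fun r => B (w r) := B.continuous.comp w.continuous
  ext t
  have h1 : u t = V (t + s) x +
      ∫ r in (0 : ℝ)..(t + s : ℝ≥0), V (((t + s : ℝ≥0) : ℝ) - r).toNNReal (B (w r.toNNReal)) :=
    hV.perturbed_eq hB (t + s) x
  have h2 : w s = V s x + ∫ r in (0 : ℝ)..s, V (s - r).toNNReal (B (w r.toNNReal)) :=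
    hV.perturbed_eq hB s x
  have hint : ∀ a b c : ℝ, IntervalIntegrable
      (fun r : ℝ => V (c - r).toNNReal (B (w r.toNNReal))) volume a b := fun a b c =>
    (hV.continuous_integrand_right hg c).intervalIntegrable _ _
  have h3 : V t (∫ r in (0 : ℝ)..s, V (s - r).toNNReal (B (w r.toNNReal))) =
      ∫ r in (0 : ℝ)..s, V (((t + s : ℝ≥0) : ℝ) - r).toNNReal (B (w r.toNNReal)) := by
    rw [← ContinuousLinearMap.intervalIntegral_comp_comm _ (hint _ _ _)]
    refine intervalIntegral.integral_congr fun r hr => ?_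
    rw [Set.uIcc_of_le (NNReal.coe_nonneg s)] at hr
    have : (((t + s : ℝ≥0) : ℝ) - r).toNNReal = t + (s - r).toNNReal := by
      rw [NNReal.coe_add, add_sub_assoc, Real.toNNReal_add (NNReal.coe_nonneg t) (by linarith [hr.2])]
      simp
    simp only [this, hV.map_add, ContinuousLinearMap.comp_apply]
  have h4 : hV.volterra B u t =
      ∫ r in (s : ℝ)..(t + s : ℝ≥0), V (((t + s : ℝ≥0) : ℝ) - r).toNNReal (B (w r.toNNReal)) := by
    have := intervalIntegral.integral_comp_add_right (a := 0) (b := (t : ℝ))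
      (fun r => V (((t + s : ℝ≥0) : ℝ) - r).toNNReal (B (w r.toNNReal))) (s : ℝ)
    rw [zero_add] at this
    rw [NNReal.coe_add] at this ⊢
    rw [← this, volterra_apply]
    refine intervalIntegral.integral_congr fun r hr => ?_
    rw [Set.uIcc_of_le (NNReal.coe_nonneg t)] at hr
    have h5 : (r + s).toNNReal = r.toNNReal + s := by
      rw [Real.toNNReal_add hr.1 (NNReal.coe_nonneg s), Real.toNNReal_coe]
    have h6 : (t + s - (r + s) : ℝ) = t - r := by ring
    simp only [h5, h6]
    rfl
  rw [h1, BoundedContinuousFunction.add_apply, orbit_apply, h4, h2, map_add, h3, hV.map_add,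
    ContinuousLinearMap.comp_apply, add_assoc,
    intervalIntegral.integral_add_adjacent_intervals (hint _ _ _) (hint _ _ _)]

theorem isC0Semigroup_perturbed (hV : IsDecayingSemigroup V l) {B : E →L[ℝ] E} (hB : ‖B‖ < l) :
    IsC0Semigroup (hV.perturbed B) := by
  have h0 : hV.perturbed B 0 = ContinuousLinearMap.id ℝ E := by
    ext x
    rw [hV.perturbed_eq hB]
    simp [hV.map_zero]
  refine ⟨h0, fun t s => ?_, fun x => ?_⟩
  · ext x
    exact hV.perturbed_add hB t s x
  · exact (hV.continuous_perturbed B x).tendsto' 0 x (by rw [h0]; rfl)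

/-- The integrand depends on `h` as well, so the integral is rescaled to `[0, 1]`, where it is
continuous in `h`. -/
theorem tendsto_average_parametric {F : ℝ → ℝ → E} (hF : Continuous (Function.uncurry F)) :
    Tendsto (fun h : ℝ≥0 => (h : ℝ)⁻¹ • ∫ s in (0 : ℝ)..h, F h s) (𝓝[>] 0) (𝓝 (F 0 0)) := by
  have hc : Continuous fun h : ℝ => ∫ s in (0 : ℝ)..1, F h (h * s) :=
    intervalIntegral.continuous_parametric_intervalIntegral_of_continuous'
      (f := fun h s => F h (h * s))
      (hF.comp (by fun_prop : Continuous fun p : ℝ × ℝ => (p.1, p.1 * p.2))) 0 1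
  have h0 := (hc.tendsto' 0 (F 0 0) (by simp)).comp
    (tendsto_coe_nhdsGT_zero.mono_right nhdsWithin_le_nhds)
  refine h0.congr' ?_
  filter_upwards [self_mem_nhdsWithin] with h hh
  have hne : (h : ℝ) ≠ 0 := by
    have : 0 < h := hh
    positivity
  simp only [Function.comp_apply]
  rw [intervalIntegral.integral_comp_mul_left (fun s => F h s) hne]
  simp

/-- The difference quotients of the two semigroups differ by the average of `V (h - s) B (u s)` over
`[0, h]`, which tends to `B x`. -/
theorem isGen_perturbed_iff (hV : IsDecayingSemigroup V l) {B : E →L[ℝ] E} (hB : ‖B‖ < l)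
    {x y : E} : IsGen (hV.perturbed B) x (y + B x) ↔ IsGen V x y := by
  have hg : Continuous fun r => B (hV.perturbed B r x) :=
    B.continuous.comp (hV.continuous_perturbed B x)
  have h0 := tendsto_average_parametric (hV.continuous_integrand hg)
  simp only [sub_zero, Real.toNNReal_zero, hV.map_zero, (hV.isC0Semigroup_perturbed hB).map_zero,
    ContinuousLinearMap.id_apply] at h0
  have e : ∀ h : ℝ≥0, (h : ℝ)⁻¹ • (hV.perturbed B h x - x) = (h : ℝ)⁻¹ • (V h x - x) +
      (h : ℝ)⁻¹ • ∫ s in (0 : ℝ)..h, V (h - s).toNNReal (B (hV.perturbed B s.toNNReal x)) := by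
    intro h
    rw [hV.perturbed_eq hB, ← smul_add]
    congr 1
    abel
  constructor
  · intro H
    have := Tendsto.sub H h0
    rw [add_sub_cancel_right] at this
    refine this.congr fun h => ?_
    rw [e]
    abel
  · intro H
    exact (Tendsto.add H h0).congr fun h => (e h).symm

/-- Every term of the Neumann series is positive, since `V` and `B` preserve positivity. -/
theorem perturbed_nonneg [PartialOrder E] [IsOrderedAddMonoid E] [IsOrderedModule ℝ E]
    [OrderClosedTopology E] (hV : IsDecayingSemigroup V l) {B : E →L[ℝ] E} (hB : ‖B‖ < l)
    (hpos : ∀ t x, 0 ≤ x → 0 ≤ V t x) (hBpos : ∀ x, 0 ≤ x → 0 ≤ B x) (t : ℝ≥0) {x : E}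
    (hx : 0 ≤ x) : 0 ≤ hV.perturbed B t x := by
  have hm : ∀ (m : ℕ) (t : ℝ≥0), 0 ≤ (hV.volterra B ^ m) (hV.orbit x) t := by
    intro m
    induction m with
    | zero => exact fun t => hpos t x hx
    | succ m ih =>
      intro t
      rw [pow_succ', mul_apply_eq_comp, volterra_apply,
        intervalIntegral.integral_of_le (NNReal.coe_nonneg t)]
      exact integral_nonneg fun s => hpos _ _ (hBpos _ (ih _))
  have hs : Summable fun m : ℕ => hV.volterra B ^ m :=
    summable_geometric_of_norm_lt_one (hV.norm_volterra_lt_one hB)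
  have h1 := hs.hasSum.mapL (((BoundedContinuousFunction.evalCLM ℝ t).comp
    (ContinuousLinearMap.apply ℝ (ℝ≥0 →ᵇ E) (hV.orbit x))))
  exact h1.nonneg fun m => hm m t

end IsDecayingSemigroup

variable [CompleteSpace E] [PartialOrder E] [IsOrderedAddMonoid E] [IsOrderedModule ℝ E]
  [OrderClosedTopology E]

/-- Bounded perturbation theorem for contraction semigroups, with positivity. -/
theorem IsC0Semigroup.exists_perturbation {T : ℝ≥0 → E →L[ℝ] E} (hT : IsC0Semigroup T)
    (hb : ∀ t x, ‖T t x‖ ≤ ‖x‖) (hpos : ∀ t x, 0 ≤ x → 0 ≤ T t x) (A : E →L[ℝ] E) {M : ℝ}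
    (hA : ∀ x, 0 ≤ x → 0 ≤ A x + M • x) :
    ∃ U : ℝ≥0 → E →L[ℝ] E, IsC0Semigroup U ∧ (∀ x, Continuous fun t => U t x) ∧
      (∀ t x, 0 ≤ x → 0 ≤ U t x) ∧ ∀ x y, IsGen U x (y + A x) ↔ IsGen T x y := by
  -- The shift by `M` makes the perturbation positive, and damping `T` at rate `l > ‖B‖` makes the
  -- series converge. The final rescaling by `l - M` undoes both: `(G - l) + (A + M) + (l - M) = G +
  -- A`.
  let B : E →L[ℝ] E := A + M • ContinuousLinearMap.id ℝ E
  let l : ℝ := ‖B‖ + 1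
  have hB : ‖B‖ < l := lt_add_one _
  have hV := hT.isDecayingSemigroup_rescale hb (l := l) (by positivity)
  have hexp : ∀ c x : ℝ, ∀ y : E, 0 ≤ y → 0 ≤ Real.exp (c * x) • y := fun c x y hy =>
    smul_nonneg (Real.exp_pos _).le hy
  have hresc : ∀ (c : ℝ) (S : ℝ≥0 → E →L[ℝ] E), rescale (-c) (rescale c S) = S := by
    intro c S
    ext t x
    simp [rescale, smul_smul, ← Real.exp_add]
  refine ⟨rescale (l - M) (hV.perturbed B), (hV.isC0Semigroup_perturbed hB).rescaled _, fun x => ?_,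
    fun t x hx => hexp _ _ _ (hV.perturbed_nonneg hB (fun t x hx => hexp _ _ _ (hpos t x hx)) hA t
      hx), fun x y => ?_⟩
  · have h1 : Continuous fun t : ℝ≥0 => Real.exp ((l - M) * t) := by fun_prop
    exact h1.smul (hV.continuous_perturbed B x)
  · have e : y + A x + (-(l - M)) • x = y + (-l) • x + B x := by
      simp only [B, add_apply, smul_apply, ContinuousLinearMap.id_apply]
      module
    constructor
    · intro H
      have h1 := H.rescaled (-(l - M))
      rw [hresc, e, hV.isGen_perturbed_iff hB] at h1
      have h2 := h1.rescaled l
      have h3 := hresc (-l) T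
      rw [neg_neg] at h3
      rw [h3] at h2
      exact h2.congr (by module)
    · intro H
      have h1 := (hV.isGen_perturbed_iff hB).2 (H.rescaled (-l))
      rw [← e] at h1
      exact (h1.rescaled (l - M)).congr (by module)

end Perturbation

/-! ### Mass and positivity on `L¹` -/

section LOne

variable {X : Type*} [MeasurableSpace X] {ν : Measure X}

instance isOrderedModule_Lp : IsOrderedModule ℝ (Lp ℝ 1 ν) where
  smul_le_smul_of_nonneg_left c hc f g hfg := by
    rw [← Lp.coeFn_le] at hfg ⊢
    filter_upwards [hfg, Lp.coeFn_smul c f, Lp.coeFn_smul c g] with x h1 h2 h3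
    rw [h2, h3]
    exact mul_le_mul_of_nonneg_left h1 hc
  smul_le_smul_of_nonneg_right f hf c d hcd := by
    have hf' := (Lp.coeFn_nonneg f).2 hf
    rw [← Lp.coeFn_le]
    filter_upwards [hf', Lp.coeFn_smul c f, Lp.coeFn_smul d f] with x h1 h2 h3
    rw [h2, h3]
    exact mul_le_mul_of_nonneg_right hcd h1

/-- The total mass `ρ ↦ ∫ ρ dν`. -/
def mass (ν : Measure X) : Lp ℝ 1 ν →L[ℝ] ℝ where
  toFun ρ := ∫ x, ρ x ∂ν
  map_add' f g := by
    rw [← integral_add (L1.integrable_coeFn f) (L1.integrable_coeFn g)]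
    exact integral_congr_ae (Lp.coeFn_add f g)
  map_smul' c f := by
    rw [RingHom.id_apply, smul_eq_mul, ← integral_const_mul]
    exact integral_congr_ae (Lp.coeFn_smul c f)
  cont := continuous_integral

theorem mass_apply (ρ : Lp ℝ 1 ν) : mass ν ρ = ∫ x, ρ x ∂ν := rfl

theorem norm_eq_mass_abs (ρ : Lp ℝ 1 ν) : ‖ρ‖ = mass ν |ρ| := by
  rw [L1.norm_eq_integral_norm, mass_apply]
  refine integral_congr_ae ?_
  filter_upwards [Lp.coeFn_abs ρ] with x hx
  rw [hx, Real.norm_eq_abs]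

/-- Positivity gives `|P ρ| ≤ P |ρ|`, and on positive functions the norm is the mass. -/
theorem norm_le_of_positive_of_mass {P : Lp ℝ 1 ν →L[ℝ] Lp ℝ 1 ν} (hpos : ∀ ρ, 0 ≤ ρ → 0 ≤ P ρ)
    (hmass : ∀ ρ, mass ν (P ρ) = mass ν ρ) (ρ : Lp ℝ 1 ν) : ‖P ρ‖ ≤ ‖ρ‖ := by
  have hmono : ∀ f g, f ≤ g → P f ≤ P g := fun f g h => by
    have := hpos (g - f) (sub_nonneg.2 h)
    rwa [map_sub, sub_nonneg] at this
  have h1 : |P ρ| ≤ P |ρ| := by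
    refine abs_le'.2 ⟨hmono _ _ (le_abs_self ρ), ?_⟩
    rw [← map_neg]
    exact hmono _ _ (neg_le_abs ρ)
  have h2 : |P ρ| ≤ |P (|ρ|)| := h1.trans (le_abs_self _)
  calc ‖P ρ‖ ≤ ‖P (|ρ|)‖ := norm_le_norm_of_abs_le_abs h2
    _ = mass ν (P (|ρ|)) := by rw [norm_eq_mass_abs, abs_of_nonneg (hpos _ (abs_nonneg ρ))]
    _ = ‖ρ‖ := by rw [hmass, norm_eq_mass_abs]

theorem IsAdjointMarkovSemigroup.norm_le {S : ℝ≥0 → Lp ℝ 1 ν →L[ℝ] Lp ℝ 1 ν}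
    (hS : IsAdjointMarkovSemigroup ν S) (t : ℝ≥0) (ρ : Lp ℝ 1 ν) : ‖S t ρ‖ ≤ ‖ρ‖ :=
  norm_le_of_positive_of_mass (hS.nonneg t) (hS.integral_eq t) ρ

/-- A functional that vanishes on the range of the generator is conserved by the semigroup. -/
theorem IsC0Semigroup.map_eq_of_isGen {E : Type*} [NormedAddCommGroup E] [NormedSpace ℝ E]
    [CompleteSpace E] {S : ℝ≥0 → E →L[ℝ] E} (hS : IsC0Semigroup S)
    (hc : ∀ x, Continuous fun t => S t x) (m : E →L[ℝ] ℝ) (hm : ∀ x y, IsGen S x y → m y = 0)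
    (t : ℝ≥0) (x : E) : m (S t x) = m x := by
  refine congrFun (Continuous.ext_on (hS.dense_domain hc) (m.continuous.comp (S t).continuous)
    m.continuous ?_) x
  rintro x ⟨y, hxy⟩
  have h1 := hS.integral_eq_sub hc hxy t.2
  have h2 := congrArg m h1
  -- The integrand `m (S s y)` vanishes because `S s y` is the value of the generator at `S s x`.
  rw [← ContinuousLinearMap.intervalIntegral_comp_comm _
    ((continuous_toNNReal_orbit hc y).intervalIntegrable _ _)] at h2
  simp only [hm _ _ (hxy.map hS _), intervalIntegral.integral_zero, map_sub] at h2
  simpa [sub_eq_zero] using h2.symm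

variable [IsFiniteMeasure ν]

/-- The indicator function of a measurable set, in `L¹`. -/
def indicatorL1 (ν : Measure X) [IsFiniteMeasure ν] {s : Set X} (hs : MeasurableSet s) :
    Lp ℝ 1 ν := indicatorConstLp 1 hs (measure_ne_top ν s) 1

theorem coeFn_indicatorL1 {s : Set X} (hs : MeasurableSet s) :
    indicatorL1 ν hs =ᵐ[ν] s.indicator fun _ => 1 := indicatorConstLp_coeFn

theorem eq_top_of_indicatorL1_mem {C : Submodule ℝ (Lp ℝ 1 ν)}
    (hC : IsClosed (C : Set (Lp ℝ 1 ν)))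
    (h : ∀ (s : Set X) (hs : MeasurableSet s), indicatorL1 ν hs ∈ C) : C = ⊤ := by
  rw [Submodule.eq_top_iff']
  refine Lp.induction (by simp) _ ?_ ?_ hC
  · intro c s hs hμs
    have e : indicatorConstLp 1 hs hμs.ne c = c • indicatorL1 ν hs := by
      ext1
      filter_upwards [indicatorConstLp_coeFn (p := 1) (hs := hs) (hμs := hμs.ne) (c := c),
        Lp.coeFn_smul c (indicatorL1 ν hs), coeFn_indicatorL1 (ν := ν) hs] with x h1 h2 h3
      rw [h1, h2, Pi.smul_apply, h3]
      by_cases hx : x ∈ s <;> simp [hx]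
    rw [Lp.simpleFunc.coe_indicatorConst, e]
    exact C.smul_mem c (h s hs)
  · intro f g hf hg _ h1 h2
    exact C.add_mem h1 h2

end LOne

/-! ### Tensor products -/

theorem prod_update_apply {X : Type*} {N : ℕ} (f : Fin N → X → ℝ) (i : Fin N) (g : X → ℝ) (x : Fin N → X) :
    ∏ j, Function.update f i g j (x j) = g (x i) * ∏ j ∈ Finset.univ.erase i, f j (x j) := by
  rw [← Finset.mul_prod_erase _ _ (Finset.mem_univ i), Function.update_self]
  congr 1
  refine Finset.prod_congr rfl fun j hj => ?_
  rw [Function.update_of_ne (Finset.ne_of_mem_erase hj)]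

section Tensor

variable {X : Type*} [MeasurableSpace X] {ν : Measure X} [IsFiniteMeasure ν] {N : ℕ}

theorem coeFn_tensor (f : Fin N → Lp ℝ 1 ν) :
    tensor ν f =ᵐ[prodMeasure ν N] fun x => ∏ i, f i (x i) := Integrable.coeFn_toL1 _

theorem ae_prodMeasure_eval {p : X → Prop} (hp : ∀ᵐ x ∂ν, p x) (i : Fin N) :
    ∀ᵐ x ∂(prodMeasure ν N), p (x i) :=
  (Measure.quasiMeasurePreserving_eval (fun _ => ν) i).ae hp

theorem coeFn_tensor_update (f : Fin N → Lp ℝ 1 ν) (i : Fin N) (g : Lp ℝ 1 ν) :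
    tensor ν (Function.update f i g) =ᵐ[prodMeasure ν N]
      fun x => g (x i) * ∏ j ∈ Finset.univ.erase i, f j (x j) := by
  filter_upwards [coeFn_tensor (Function.update f i g)] with x hx
  rw [hx, ← prod_update_apply (fun j => f j)]
  refine Finset.prod_congr rfl fun j _ => ?_
  by_cases h : j = i
  · subst h; simp
  · simp [h]

theorem norm_tensor (f : Fin N → Lp ℝ 1 ν) : ‖tensor ν f‖ = ∏ i, ‖f i‖ := by
  simp only [L1.norm_eq_integral_norm]
  rw [← integral_fintype_prod_eq_prod (μ := fun _ => ν) (fun i x => ‖f i x‖)]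
  refine integral_congr_ae ?_
  filter_upwards [coeFn_tensor f] with x hx
  rw [hx, norm_prod]

/-- The tensor product as a continuous multilinear map. -/
def tensorCMM (ν : Measure X) [IsFiniteMeasure ν] (N : ℕ) :
    ContinuousMultilinearMap ℝ (fun _ : Fin N => Lp ℝ 1 ν) (Lp ℝ 1 (prodMeasure ν N)) :=
  MultilinearMap.mkContinuous
    { toFun := tensor ν
      map_update_add' := by
        intro inst f i g h
        obtain rfl : inst = instDecidableEqFin N := Subsingleton.elim _ _
        ext1
        filter_upwards [coeFn_tensor_update f i (g + h), coeFn_tensor_update f i g,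
          coeFn_tensor_update f i h, ae_prodMeasure_eval (Lp.coeFn_add g h) i,
          Lp.coeFn_add (tensor ν (Function.update f i g)) (tensor ν (Function.update f i h))]
          with x h1 h2 h3 h4 h5
        rw [h1, h5, Pi.add_apply, h2, h3, h4, Pi.add_apply, add_mul]
      map_update_smul' := by
        intro inst f i c g
        obtain rfl : inst = instDecidableEqFin N := Subsingleton.elim _ _
        ext1
        filter_upwards [coeFn_tensor_update f i (c • g), coeFn_tensor_update f i g,
          ae_prodMeasure_eval (Lp.coeFn_smul c g) i,
          Lp.coeFn_smul c (tensor ν (Function.update f i g))] with x h1 h2 h3 h4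
        rw [h1, h4, Pi.smul_apply, h2, h3, Pi.smul_apply, smul_eq_mul, smul_eq_mul, mul_assoc] }
    1 fun f => by rw [one_mul]; exact (norm_tensor f).le

theorem tensor_indicatorL1 {s : Fin N → Set X} (hs : ∀ i, MeasurableSet (s i)) :
    tensor ν (fun i => indicatorL1 ν (hs i)) =
      indicatorL1 (prodMeasure ν N) (MeasurableSet.univ_pi hs) := by
  ext1
  have h : ∀ᵐ x ∂(prodMeasure ν N), ∀ i, indicatorL1 ν (hs i) (x i) =
      (s i).indicator (fun _ => 1) (x i) :=
    ae_all_iff.2 fun i => ae_prodMeasure_eval (coeFn_indicatorL1 (hs i)) i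
  filter_upwards [coeFn_tensor fun i => indicatorL1 ν (hs i), h,
    coeFn_indicatorL1 (ν := prodMeasure ν N) (MeasurableSet.univ_pi hs)] with x h1 h2 h3
  rw [h1, h3]
  simp only [h2]
  by_cases hx : ∀ i, x i ∈ s i
  · rw [Set.indicator_of_mem (by simpa using hx)]
    exact Finset.prod_eq_one fun i _ => Set.indicator_of_mem (hx i) _
  · rw [Set.indicator_of_notMem (by simpa using hx)]
    push Not at hx
    obtain ⟨i, hi⟩ := hx
    exact Finset.prod_eq_zero (Finset.mem_univ i) (Set.indicator_of_notMem hi _)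

/-- Dynkin's theorem: boxes form a generating π-system. Complements are differences from the full
box, and countable disjoint unions are `L¹`-limits of finite ones because the measure is finite. -/
theorem indicatorL1_mem_of_box {C : Submodule ℝ (Lp ℝ 1 (prodMeasure ν N))}
    (hC : IsClosed (C : Set (Lp ℝ 1 (prodMeasure ν N))))
    (h : ∀ (s : Fin N → Set X) (hs : ∀ i, MeasurableSet (s i)),
      indicatorL1 (prodMeasure ν N) (MeasurableSet.univ_pi hs) ∈ C)
    (A : Set (Fin N → X)) (hA : MeasurableSet A) : indicatorL1 (prodMeasure ν N) hA ∈ C := by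
  refine MeasurableSpace.induction_on_inter
    (C := fun A hA => indicatorL1 (prodMeasure ν N) hA ∈ C) generateFrom_pi.symm isPiSystem_pi
    ?_ ?_ ?_ ?_ A hA
  · rw [indicatorL1, indicatorConstLp_empty]
    exact C.zero_mem
  · rintro _ ⟨s, hs, rfl⟩
    exact h s fun i => hs i trivial
  · intro t ht ih
    have e : indicatorL1 (prodMeasure ν N) ht.compl =
        indicatorL1 (prodMeasure ν N) (MeasurableSet.univ_pi fun _ : Fin N => .univ) -
          indicatorL1 (prodMeasure ν N) ht := by
      ext1
      filter_upwards [coeFn_indicatorL1 (ν := prodMeasure ν N) ht.compl,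
        coeFn_indicatorL1 (ν := prodMeasure ν N) ht,
        coeFn_indicatorL1 (ν := prodMeasure ν N) (MeasurableSet.univ_pi fun _ : Fin N => .univ),
        Lp.coeFn_sub (indicatorL1 (prodMeasure ν N) (MeasurableSet.univ_pi fun _ : Fin N => .univ))
          (indicatorL1 (prodMeasure ν N) ht)] with x h1 h2 h3 h4
      rw [h1, h4, Pi.sub_apply, h2, h3]
      by_cases hx : x ∈ t <;> simp [hx]
    rw [e]
    exact C.sub_mem (h _ fun _ => .univ) ih
  · intro f hf hfm ih
    have hm : ∀ n, MeasurableSet (⋃ i < n, f i) := fun n =>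
      MeasurableSet.iUnion fun i => MeasurableSet.iUnion fun _ => hfm i
    have hmem : ∀ n, indicatorL1 (prodMeasure ν N) (hm n) ∈ C := by
      intro n
      induction n with
      | zero =>
        have e : indicatorL1 (prodMeasure ν N) (hm 0) = 0 := by
          ext1
          filter_upwards [coeFn_indicatorL1 (ν := prodMeasure ν N) (hm 0),
            Lp.coeFn_zero ℝ 1 (prodMeasure ν N)] with x h1 h2
          rw [h1, h2]
          simp
        rw [e]
        exact C.zero_mem
      | succ n ihn =>
        have e : indicatorL1 (prodMeasure ν N) (hm (n + 1)) =
            indicatorL1 (prodMeasure ν N) (hm n) + indicatorL1 (prodMeasure ν N) (hfm n) := by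
          ext1
          filter_upwards [coeFn_indicatorL1 (ν := prodMeasure ν N) (hm (n + 1)),
            coeFn_indicatorL1 (ν := prodMeasure ν N) (hm n),
            coeFn_indicatorL1 (ν := prodMeasure ν N) (hfm n),
            Lp.coeFn_add (indicatorL1 (prodMeasure ν N) (hm n))
              (indicatorL1 (prodMeasure ν N) (hfm n))] with x h1 h2 h3 h4
          rw [h1, h4, Pi.add_apply, h2, h3, Set.biUnion_lt_succ,
            Set.indicator_union_of_disjoint]
          refine Set.disjoint_iUnion₂_left.2 fun i hi => hf hi.ne
        rw [e]
        exact C.add_mem ihn (ih n)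
    refine hC.mem_of_tendsto (tendsto_indicatorConstLp_set (p := 1) (l := atTop)
      (t := fun n => ⋃ i < n, f i) (by simp) ?_) (Eventually.of_forall hmem)
    have hmono : Monotone fun n => ⋃ i < n, f i := fun a b hab =>
      Set.biUnion_subset_biUnion_left fun i hi => lt_of_lt_of_le hi hab
    have hU : ⋃ n, ⋃ i < n, f i = ⋃ i, f i := by
      ext x
      simp only [Set.mem_iUnion]
      exact ⟨fun ⟨_, i, _, hi⟩ => ⟨i, hi⟩, fun ⟨i, hi⟩ => ⟨i + 1, i, i.lt_succ_self, hi⟩⟩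
    have hlim := tendsto_measure_iUnion_atTop (μ := prodMeasure ν N) hmono
    rw [hU] at hlim
    have hsub : ∀ n, (⋃ i < n, f i) ⊆ ⋃ i, f i := fun n => hU ▸
      Set.subset_iUnion (fun n => ⋃ i < n, f i) n
    have e : ∀ n, prodMeasure ν N (symmDiff (⋃ i < n, f i) (⋃ i, f i)) =
        prodMeasure ν N (⋃ i, f i) - prodMeasure ν N (⋃ i < n, f i) := fun n => by
      rw [symmDiff_of_le (hsub n)]
      exact measure_sdiff (hsub n) (hm n).nullMeasurableSet (measure_ne_top _ _)
    simp only [e]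
    have := ENNReal.Tendsto.sub (tendsto_const_nhds (x := prodMeasure ν N (⋃ i, f i))) hlim
      (Or.inl (measure_ne_top _ _))
    simpa using this

/-- Tensor products of functions in a dense set are total in `L¹(ν^{⊗N})`. -/
theorem span_tensor_topologicalClosure {D : Set (Lp ℝ 1 ν)} (hD : Dense D) :
    (Submodule.span ℝ {ρ | ∃ f : Fin N → Lp ℝ 1 ν, (∀ i, f i ∈ D) ∧
      ρ = tensor ν f}).topologicalClosure = ⊤ := by
  have hC := Submodule.isClosed_topologicalClosure (Submodule.span ℝ
    {ρ | ∃ f : Fin N → Lp ℝ 1 ν, (∀ i, f i ∈ D) ∧ ρ = tensor ν f})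
  have h1 : ∀ f : Fin N → Lp ℝ 1 ν, tensor ν f ∈ (Submodule.span ℝ {ρ | ∃ f : Fin N → Lp ℝ 1 ν,
      (∀ i, f i ∈ D) ∧ ρ = tensor ν f}).topologicalClosure := by
    intro f
    refine closure_minimal ?_ (hC.preimage (tensorCMM ν N).cont)
      (dense_pi Set.univ (fun _ _ => hD) f)
    intro g hg
    exact Submodule.le_topologicalClosure _
      (Submodule.subset_span ⟨g, fun i => hg i trivial, rfl⟩)
  refine eq_top_of_indicatorL1_mem hC (indicatorL1_mem_of_box hC fun s hs => ?_)
  rw [← tensor_indicatorL1 hs]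
  exact h1 _

theorem continuousLinearMap_ext_tensor {F : Type*} [NormedAddCommGroup F] [NormedSpace ℝ F]
    {P Q : Lp ℝ 1 (prodMeasure ν N) →L[ℝ] F} (h : ∀ f, P (tensor ν f) = Q (tensor ν f)) :
    P = Q := by
  have h0 := span_tensor_topologicalClosure (ν := ν) (N := N) dense_univ
  refine ContinuousLinearMap.ext_on (Submodule.dense_iff_topologicalClosure_eq_top.2 h0) ?_
  rintro _ ⟨f, _, rfl⟩
  exact h f

end Tensor

/-! ### Operators acting on the slices -/

/-- A closed linear relation that is bounded and densely defined is the graph of a bounded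
operator. -/
theorem exists_continuousLinearMap_of_graph {E : Type*} [NormedAddCommGroup E] [NormedSpace ℝ E]
    [CompleteSpace E] {G : Submodule ℝ (E × E)} (hG : IsClosed (G : Set (E × E))) {C : ℝ≥0}
    (hb : ∀ p ∈ G, ‖p.2‖ ≤ C * ‖p.1‖) (hd : (G.map (LinearMap.fst ℝ E E)).topologicalClosure = ⊤) :
    ∃ F : E →L[ℝ] E, ∀ x y, (x, y) ∈ G ↔ y = F x := by
  have hcomp : CompleteSpace G := hG.completeSpace_coe
  let f : G →L[ℝ] E := (ContinuousLinearMap.fst ℝ E E).comp G.subtypeL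
  -- On `G` the first projection is bounded below, hence injective with closed range; as the range
  -- is dense, it is invertible.
  have hf : ∀ p : G, ‖p‖ ≤ (max 1 C : ℝ≥0) * ‖f p‖ := by
    intro p
    change ‖(p : E × E)‖ ≤ (max 1 C : ℝ≥0) * ‖(p : E × E).1‖
    rw [Prod.norm_def, NNReal.coe_max, NNReal.coe_one]
    refine max_le ?_ ((hb p p.2).trans ?_)
    · exact le_mul_of_one_le_left (norm_nonneg _) (le_max_left _ _)
    · exact mul_le_mul_of_nonneg_right (le_max_right _ _) (norm_nonneg _)
  have hanti : AntilipschitzWith (max 1 C) f := AddMonoidHomClass.antilipschitz_of_bound f hf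
  have hker : (f : G →ₗ[ℝ] E).ker = ⊥ := LinearMap.ker_eq_bot.2 hanti.injective
  have hrange : (f : G →ₗ[ℝ] E).range = ⊤ := by
    have hcl : IsClosed (Set.range f) := hanti.isClosed_range f.uniformContinuous
    have e : ((G.map (LinearMap.fst ℝ E E) : Submodule ℝ E) : Set E) = Set.range f := by
      ext x
      simp only [Submodule.map_coe, Set.mem_image, SetLike.mem_coe, Set.mem_range]
      exact ⟨fun ⟨p, hp, h⟩ => ⟨⟨p, hp⟩, h⟩, fun ⟨p, h⟩ => ⟨p, p.2, h⟩⟩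
    rw [Submodule.eq_top_iff'] at hd ⊢
    intro x
    have hx : x ∈ closure (Set.range f) := e ▸ hd x
    rw [hcl.closure_eq] at hx
    exact hx
  let e := ContinuousLinearEquiv.ofBijective f hker hrange
  refine ⟨(ContinuousLinearMap.snd ℝ E E).comp (G.subtypeL.comp (e.symm : E →L[ℝ] G)),
    fun x y => ⟨fun h => ?_, fun h => ?_⟩⟩
  · have h1 : e.symm x = ⟨(x, y), h⟩ :=
      ContinuousLinearEquiv.ofBijective_symm_apply_apply f hker hrange ⟨(x, y), h⟩
    simp [h1]
  · have h1 : f (e.symm x) = x := ContinuousLinearEquiv.ofBijective_apply_symm_apply f hker hrange x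
    have h2 : ((e.symm x : G) : E × E) = (x, y) := Prod.ext h1 h.symm
    exact h2 ▸ (e.symm x).2

theorem enorm_le_of_norm_le {E : Type*} [NormedAddCommGroup E] {C : ℝ≥0} {x y : E}
    (h : ‖x‖ ≤ C * ‖y‖) : ‖x‖ₑ ≤ C * ‖y‖ₑ := by
  rw [enorm_eq_nnnorm, enorm_eq_nnnorm, ← ENNReal.coe_mul, ENNReal.coe_le_coe]
  exact h

section Fiberwise

variable {X : Type*} [MeasurableSpace X] {ν : Measure X} [IsFiniteMeasure ν] {n : ℕ}
  {k : Fin (n + 1)}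

theorem measurable_insertNth (k : Fin (n + 1)) :
    Measurable fun q : X × (Fin n → X) => (k.insertNth q.1 q.2 : Fin (n + 1) → X) :=
  (MeasurableEquiv.piFinSuccAbove (fun _ : Fin (n + 1) => X) k).symm.measurable

theorem measurePreserving_insertNth (ν : Measure X) [IsFiniteMeasure ν] (k : Fin (n + 1)) :
    MeasurePreserving (fun q : X × (Fin n → X) => (k.insertNth q.1 q.2 : Fin (n + 1) → X))
      (ν.prod (prodMeasure ν n)) (prodMeasure ν (n + 1)) :=
  (measurePreserving_piFinSuccAbove (fun _ : Fin (n + 1) => ν) k).symm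

theorem lintegral_slice (k : Fin (n + 1)) {g : (Fin (n + 1) → X) → ℝ≥0∞} (hg : Measurable g) :
    ∫⁻ z, ∫⁻ s, g (k.insertNth s z) ∂ν ∂(prodMeasure ν n) = ∫⁻ x, g x ∂(prodMeasure ν (n + 1)) := by
  rw [← (measurePreserving_insertNth ν k).lintegral_comp hg, lintegral_prod_symm]
  exact (hg.comp (measurable_insertNth k)).aemeasurable

theorem integral_slice (k : Fin (n + 1)) {g : (Fin (n + 1) → X) → ℝ}
    (hg : Integrable g (prodMeasure ν (n + 1))) :
    ∫ z, ∫ s, g (k.insertNth s z) ∂ν ∂(prodMeasure ν n) = ∫ x, g x ∂(prodMeasure ν (n + 1)) := by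
  have h1 := (measurePreserving_piFinSuccAbove (fun _ : Fin (n + 1) => ν) k).symm.integral_comp' g
  rw [← h1]
  exact (integral_prod_symm _
    ((measurePreserving_insertNth ν k).integrable_comp_of_integrable hg)).symm

theorem ae_of_ae_slice (k : Fin (n + 1)) {p : (Fin (n + 1) → X) → Prop}
    (hp : MeasurableSet {x | p x})
    (h : ∀ᵐ z ∂(prodMeasure ν n), ∀ᵐ s ∂ν, p (k.insertNth s z)) :
    ∀ᵐ x ∂(prodMeasure ν (n + 1)), p x := by
  have h1 := lintegral_slice (ν := ν) k (g := {x | p x}ᶜ.indicator 1)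
    (measurable_one.indicator hp.compl)
  rw [lintegral_indicator_one hp.compl, lintegral_eq_zero_of_ae_eq_zero] at h1
  · exact h1.symm
  · filter_upwards [h] with z hz
    refine lintegral_eq_zero_of_ae_eq_zero ?_
    filter_upwards [hz] with s hs
    simp [hs]

/-- The `L¹`-norm of a slice. -/
def sliceNorm (ν : Measure X) (k : Fin (n + 1)) (ρ : (Fin (n + 1) → X) → ℝ) (z : Fin n → X) :
    ℝ≥0∞ := ∫⁻ s, ‖ρ (k.insertNth s z)‖ₑ ∂ν

theorem measurable_sliceNorm (k : Fin (n + 1)) (ρ : Lp ℝ 1 (prodMeasure ν (n + 1))) :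
    Measurable (sliceNorm ν k ρ) :=
  ((Lp.stronglyMeasurable ρ).measurable.enorm.comp (measurable_insertNth k)).lintegral_prod_left'

theorem lintegral_sliceNorm (k : Fin (n + 1)) (ρ : Lp ℝ 1 (prodMeasure ν (n + 1))) :
    ∫⁻ z, sliceNorm ν k ρ z ∂(prodMeasure ν n) = ‖ρ‖ₑ := by
  rw [Lp.enorm_def, eLpNorm_one_eq_lintegral_enorm]
  exact lintegral_slice k (Lp.stronglyMeasurable ρ).measurable.enorm

theorem IsSlice.enorm_eq {ρ : Lp ℝ 1 (prodMeasure ν (n + 1))} {z : Fin n → X} {f : Lp ℝ 1 ν}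
    (h : IsSlice ν k ρ z f) : ‖f‖ₑ = sliceNorm ν k ρ z := by
  rw [Lp.enorm_def, eLpNorm_one_eq_lintegral_enorm]
  exact lintegral_congr_ae (by filter_upwards [h] with s hs; rw [hs])

theorem ae_exists_isSlice (k : Fin (n + 1)) (ρ : Lp ℝ 1 (prodMeasure ν (n + 1))) :
    ∀ᵐ z ∂(prodMeasure ν n), ∃ f, IsSlice ν k ρ z f := by
  have h := ((measurePreserving_insertNth ν k).integrable_comp_of_integrable
    (L1.integrable_coeFn ρ)).prod_left_ae
  filter_upwards [h] with z hz
  exact ⟨hz.toL1 _, hz.coeFn_toL1⟩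

theorem ae_isSlice_sub (k : Fin (n + 1)) (ρ σ : Lp ℝ 1 (prodMeasure ν (n + 1))) :
    ∀ᵐ z ∂(prodMeasure ν n), ∀ f g, IsSlice ν k ρ z f → IsSlice ν k σ z g →
      IsSlice ν k (ρ - σ) z (f - g) := by
  filter_upwards [ae_slice ν k (Lp.coeFn_sub ρ σ)] with z hz f g hf hg
  filter_upwards [hz, hf, hg, Lp.coeFn_sub f g] with s h1 h2 h3 h4
  rw [h1, h4, Pi.sub_apply, Pi.sub_apply, h2, h3]

theorem nonneg_of_ae_isSlice (k : Fin (n + 1)) {ρ : Lp ℝ 1 (prodMeasure ν (n + 1))}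
    (h : ∀ᵐ z ∂(prodMeasure ν n), ∃ f, 0 ≤ f ∧ IsSlice ν k ρ z f) : 0 ≤ ρ := by
  rw [← Lp.coeFn_nonneg]
  refine ae_of_ae_slice k (p := fun x => 0 ≤ ρ x)
    (measurableSet_le measurable_const (Lp.stronglyMeasurable ρ).measurable) ?_
  filter_upwards [h] with z ⟨f, hf, hs⟩
  filter_upwards [hs, (Lp.coeFn_nonneg f).2 hf] with s h1 h2
  rwa [← h1]

theorem ae_nonneg_of_isSlice (k : Fin (n + 1)) {ρ : Lp ℝ 1 (prodMeasure ν (n + 1))} (hρ : 0 ≤ ρ) :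
    ∀ᵐ z ∂(prodMeasure ν n), ∀ f, IsSlice ν k ρ z f → 0 ≤ f := by
  filter_upwards [ae_slice ν k ((Lp.coeFn_nonneg ρ).2 hρ)] with z hz f hf
  rw [← Lp.coeFn_nonneg]
  filter_upwards [hz, hf] with s h1 h2
  rwa [h2]

theorem mass_eq_integral_of_isSlice (k : Fin (n + 1)) {ρ : Lp ℝ 1 (prodMeasure ν (n + 1))}
    {m : (Fin n → X) → ℝ}
    (h : ∀ᵐ z ∂(prodMeasure ν n), ∃ f, IsSlice ν k ρ z f ∧ mass ν f = m z) :
    mass (prodMeasure ν (n + 1)) ρ = ∫ z, m z ∂(prodMeasure ν n) := by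
  rw [mass_apply, ← integral_slice k (L1.integrable_coeFn ρ)]
  refine integral_congr_ae ?_
  filter_upwards [h] with z ⟨f, hf, hm⟩
  rw [← hm, mass_apply]
  exact (integral_congr_ae hf).symm

/-! ### Families of operators acting in one coordinate. -/

variable {B : (Fin n → X) → Lp ℝ 1 ν →ₗ[ℝ] Lp ℝ 1 ν} {C : ℝ≥0}

theorem mem_fiberwiseGraph {p : Lp ℝ 1 (prodMeasure ν (n + 1)) × Lp ℝ 1 (prodMeasure ν (n + 1))} :
    p ∈ fiberwiseGraph ν B k ↔ ∀ᵐ z ∂(prodMeasure ν n), ∃ f : Lp ℝ 1 ν,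
      IsSlice ν k p.1 z f ∧ IsSlice ν k p.2 z (B z f) := Iff.rfl

theorem norm_le_of_mem_fiberwiseGraph (hB : ∀ z f, ‖B z f‖ ≤ C * ‖f‖)
    {p : Lp ℝ 1 (prodMeasure ν (n + 1)) × Lp ℝ 1 (prodMeasure ν (n + 1))}
    (hp : p ∈ fiberwiseGraph ν B k) : ‖p.2‖ ≤ C * ‖p.1‖ := by
  have h : ‖p.2‖ₑ ≤ C * ‖p.1‖ₑ := by
    rw [← lintegral_sliceNorm k, ← lintegral_sliceNorm k,
      ← lintegral_const_mul _ (measurable_sliceNorm k _)]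
    refine lintegral_mono_ae ?_
    filter_upwards [hp] with z ⟨f, hf, hg⟩
    rw [← hf.enorm_eq, ← hg.enorm_eq]
    exact enorm_le_of_norm_le (hB z f)
  rw [enorm_eq_nnnorm, enorm_eq_nnnorm, ← ENNReal.coe_mul, ENNReal.coe_le_coe] at h
  exact h

/-- For almost every `z` the defect `‖g - B z f‖` is at most `G z`, an infimum over the
approximating sequence whose integral is zero. The infimum replaces an almost everywhere convergent
subsequence, and no measurability of `z ↦ B z` is needed. -/
theorem isClosed_fiberwiseGraph (hB : ∀ z f, ‖B z f‖ ≤ C * ‖f‖) :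
    IsClosed (fiberwiseGraph ν B k : Set
      (Lp ℝ 1 (prodMeasure ν (n + 1)) × Lp ℝ 1 (prodMeasure ν (n + 1)))) := by
  refine isClosed_of_closure_subset fun p hp => ?_
  obtain ⟨q, hq, hlim⟩ := mem_closure_iff_seq_limit.1 hp
  let G : (Fin n → X) → ℝ≥0∞ := fun z =>
    ⨅ m, (sliceNorm ν k (p.2 - (q m).2 : Lp ℝ 1 (prodMeasure ν (n + 1))) z +
      C * sliceNorm ν k ((q m).1 - p.1 : Lp ℝ 1 (prodMeasure ν (n + 1))) z)
  have hGm : Measurable G := Measurable.iInf fun m =>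
    (measurable_sliceNorm k _).add ((measurable_sliceNorm k _).const_mul _)
  have hG : ∀ᵐ z ∂(prodMeasure ν n), G z = 0 := by
    refine (lintegral_eq_zero_iff hGm).1 (le_antisymm ?_ zero_le)
    have h1 : Tendsto (fun m => ‖p.2 - (q m).2‖ₑ + C * ‖(q m).1 - p.1‖ₑ) atTop (𝓝 0) := by
      have a1 : Tendsto (fun m => ‖p.2 - (q m).2‖ₑ) atTop (𝓝 0) := by
        have := (tendsto_const_nhds (x := p.2)).sub ((continuous_snd.tendsto p).comp hlim)
        rw [sub_self] at this
        simpa using this.enorm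
      have a2 : Tendsto (fun m => ‖(q m).1 - p.1‖ₑ) atTop (𝓝 0) := by
        have := ((continuous_fst.tendsto p).comp hlim).sub (tendsto_const_nhds (x := p.1))
        rw [sub_self] at this
        simpa using this.enorm
      simpa using a1.add (ENNReal.Tendsto.const_mul a2 (Or.inr ENNReal.coe_ne_top) :
        Tendsto (fun m => (C : ℝ≥0∞) * ‖(q m).1 - p.1‖ₑ) atTop (𝓝 (C * 0)))
    refine ge_of_tendsto h1 (Eventually.of_forall fun m => ?_)
    rw [← lintegral_sliceNorm k, ← lintegral_sliceNorm k,
      ← lintegral_const_mul _ (measurable_sliceNorm k _),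
      ← lintegral_add_left (measurable_sliceNorm k _)]
    exact lintegral_mono fun z => iInf_le _ m
  have h1 : ∀ᵐ z ∂(prodMeasure ν n), ∀ m, ∃ f : Lp ℝ 1 ν,
      IsSlice ν k (q m).1 z f ∧ IsSlice ν k (q m).2 z (B z f) := ae_all_iff.2 hq
  filter_upwards [hG, h1, ae_exists_isSlice k p.1, ae_exists_isSlice k p.2,
    ae_all_iff.2 fun m => ae_isSlice_sub k p.2 (q m).2,
    ae_all_iff.2 fun m => ae_isSlice_sub k (q m).1 p.1] with z hz hm ⟨f, hf⟩ ⟨g, hg⟩ h2 h3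
  refine ⟨f, hf, ?_⟩
  have hle : ‖g - B z f‖ₑ ≤ G z := by
    refine le_iInf fun m => ?_
    obtain ⟨f', hf', hg'⟩ := hm m
    rw [← (h2 m _ _ hg hg').enorm_eq, ← (h3 m _ _ hf' hf).enorm_eq]
    have e : g - B z f = (g - B z f') + B z (f' - f) := by
      rw [map_sub]
      abel
    rw [e]
    exact (enorm_add_le _ _).trans (add_le_add le_rfl (enorm_le_of_norm_le (hB z _)))
  rw [hz, nonpos_iff_eq_zero, enorm_eq_zero, sub_eq_zero] at hle
  exact hle ▸ hg

/-- A uniformly bounded family that acts fiberwise on a total set acts fiberwise on `L¹`. -/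
theorem exists_fiberwise (hB : ∀ z f, ‖B z f‖ ≤ C * ‖f‖)
    (hd : ((fiberwiseGraph ν B k).map (LinearMap.fst ℝ _ _)).topologicalClosure = ⊤) :
    ∃ F : Lp ℝ 1 (prodMeasure ν (n + 1)) →L[ℝ] Lp ℝ 1 (prodMeasure ν (n + 1)),
      ∀ ρ η, (ρ, η) ∈ fiberwiseGraph ν B k ↔ η = F ρ :=
  exists_continuousLinearMap_of_graph (isClosed_fiberwiseGraph hB)
    (fun _ hp => norm_le_of_mem_fiberwiseGraph hB hp) hd

theorem nonneg_of_mem_fiberwiseGraph {ρ η : Lp ℝ 1 (prodMeasure ν (n + 1))} {M : ℝ}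
    (hB : ∀ z f, 0 ≤ f → 0 ≤ B z f + M • f) (h : (ρ, η) ∈ fiberwiseGraph ν B k) (hρ : 0 ≤ ρ) :
    0 ≤ η + M • ρ := by
  refine nonneg_of_ae_isSlice k ?_
  filter_upwards [h, ae_nonneg_of_isSlice k hρ, ae_slice ν k (Lp.coeFn_add η (M • ρ)),
    ae_slice ν k (Lp.coeFn_smul M ρ)] with z ⟨f, hf, hg⟩ h1 h2 h3
  refine ⟨B z f + M • f, hB z f (h1 f hf), ?_⟩
  filter_upwards [hf, hg, h2, h3, Lp.coeFn_add (B z f) (M • f), Lp.coeFn_smul M f]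
    with s a1 a2 a3 a4 a5 a6
  rw [a5, a3, Pi.add_apply, Pi.add_apply, a4, a6, a2, Pi.smul_apply, Pi.smul_apply, a1]

theorem mass_of_mem_fiberwiseGraph {ρ η : Lp ℝ 1 (prodMeasure ν (n + 1))} {c : ℝ}
    (hB : ∀ z f, mass ν (B z f) = c * mass ν f) (h : (ρ, η) ∈ fiberwiseGraph ν B k) :
    mass (prodMeasure ν (n + 1)) η = c * mass (prodMeasure ν (n + 1)) ρ := by
  rw [← smul_eq_mul, ← map_smul]
  rw [mass_eq_integral_of_isSlice k (ρ := η) (m := fun z => c * ∫ s, ρ (k.insertNth s z) ∂ν),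
    mass_eq_integral_of_isSlice k (ρ := c • ρ) (m := fun z => c * ∫ s, ρ (k.insertNth s z) ∂ν)]
  · filter_upwards [ae_exists_isSlice k ρ, ae_slice ν k (Lp.coeFn_smul c ρ)] with z ⟨f, hf⟩ h1
    refine ⟨c • f, ?_, ?_⟩
    · filter_upwards [hf, h1, Lp.coeFn_smul c f] with s a1 a2 a3
      rw [a2, a3, Pi.smul_apply, Pi.smul_apply, a1]
    · rw [map_smul, mass_apply, integral_congr_ae hf, smul_eq_mul]
  · filter_upwards [h] with z ⟨f, hf, hg⟩
    refine ⟨_, hg, ?_⟩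
    rw [hB, mass_apply, integral_congr_ae hf]

theorem ae_isSlice_tensor (k : Fin (n + 1)) (f : Fin (n + 1) → Lp ℝ 1 ν) :
    ∀ᵐ z ∂(prodMeasure ν n),
      IsSlice ν k (tensor ν f) z ((∏ j, f (k.succAbove j) (z j)) • f k) := by
  filter_upwards [ae_slice ν k (coeFn_tensor f)] with z hz
  filter_upwards [hz, Lp.coeFn_smul (∏ j, f (k.succAbove j) (z j)) (f k)] with s h1 h2
  rw [h1, h2, Fin.prod_univ_succAbove _ k]
  simp [mul_comm]

/-- Slices of a tensor product are scalar multiples of its `k`-th factor, and `P` commutes with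
scalars. -/
theorem tensor_mem_fiberwiseGraph (k : Fin (n + 1)) (P : Lp ℝ 1 ν →ₗ[ℝ] Lp ℝ 1 ν)
    (f : Fin (n + 1) → Lp ℝ 1 ν) :
    (tensor ν f, tensor ν (Function.update f k (P (f k)))) ∈ fiberwiseGraph ν (fun _ => P) k := by
  rw [mem_fiberwiseGraph]
  filter_upwards [ae_isSlice_tensor k f,
    ae_isSlice_tensor k (Function.update f k (P (f k)))] with z h1 h2
  refine ⟨_, h1, ?_⟩
  rw [map_smul]
  simpa [Fin.succAbove_ne] using h2

/-- The action of a positive mass-conserving operator on the `k`-th coordinate. -/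
theorem exists_coordinate_operator (k : Fin (n + 1)) (P : Lp ℝ 1 ν →L[ℝ] Lp ℝ 1 ν)
    (hpos : ∀ ρ, 0 ≤ ρ → 0 ≤ P ρ) (hmass : ∀ ρ, mass ν (P ρ) = mass ν ρ) :
    ∃ F : Lp ℝ 1 (prodMeasure ν (n + 1)) →L[ℝ] Lp ℝ 1 (prodMeasure ν (n + 1)),
      (∀ f, F (tensor ν f) = tensor ν (Function.update f k (P (f k)))) ∧ (∀ ρ, 0 ≤ ρ → 0 ≤ F ρ) ∧
      ∀ ρ, mass (prodMeasure ν (n + 1)) (F ρ) = mass (prodMeasure ν (n + 1)) ρ := by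
  obtain ⟨F, hF⟩ := exists_fiberwise (ν := ν) (k := k) (B := fun _ => (P : Lp ℝ 1 ν →ₗ[ℝ] Lp ℝ 1 ν))
    (C := 1) (fun _ f => by simpa using norm_le_of_positive_of_mass hpos hmass f) (by
      rw [← top_le_iff, ← span_tensor_topologicalClosure (ν := ν) (N := n + 1) dense_univ]
      refine Submodule.topologicalClosure_mono (Submodule.span_le.2 ?_)
      rintro _ ⟨f, _, rfl⟩
      exact ⟨_, tensor_mem_fiberwiseGraph k (P : Lp ℝ 1 ν →ₗ[ℝ] Lp ℝ 1 ν) f, rfl⟩)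
  refine ⟨F, fun f => ((hF _ _).1 (tensor_mem_fiberwiseGraph k (P : Lp ℝ 1 ν →ₗ[ℝ] Lp ℝ 1 ν)
    f)).symm, fun ρ hρ => ?_, fun ρ => ?_⟩
  · simpa using nonneg_of_mem_fiberwiseGraph (M := 0) (fun _ f hf => by simpa using hpos f hf)
      ((hF ρ (F ρ)).2 rfl) hρ
  · simpa using mass_of_mem_fiberwiseGraph (c := 1) (fun _ f => by simpa using hmass f)
      ((hF ρ (F ρ)).2 rfl)

end Fiberwise

/-! ### Adjoint jump generators -/

section AdjointJumpGenerator

variable {X : Type*} [MeasurableSpace X] {ν : Measure X} {Λ Λs : Kernel X X}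
  (h : IsAdjointKernel ν Λ Λs) (hB : ∃ M : ℝ≥0, ∀ x, Λ x Set.univ ≤ M) {M : ℝ≥0}

theorem coeFn_adjointJumpGenerator (f : Lp ℝ 1 ν) :
    adjointJumpGenerator h hB f =ᵐ[ν] adjointJumpFun Λ Λs f :=
  (h.integrable_adjointJumpFun hB.choose_spec f).coeFn_toL1

theorem real_univ_le {Y : Type*} [MeasurableSpace Y] {κ : Kernel Y X} {M : ℝ≥0}
    (hM : ∀ y, κ y Set.univ ≤ M) (y : Y) : (κ y).real Set.univ ≤ M :=
  ENNReal.toReal_le_of_le_ofReal M.2 (by simpa using hM y)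

/-- Gain and loss contribute `M` each. Here `M` is any bound, not the witness chosen from `hB`, so
one constant serves all empirical measures. -/
theorem norm_adjointJumpGenerator_le (hM : ∀ x, Λ x Set.univ ≤ M) (f : Lp ℝ 1 ν) :
    ‖adjointJumpGenerator h hB f‖ ≤ (2 * M : ℝ≥0) * ‖f‖ := by
  have hf := (Lp.stronglyMeasurable f).measurable
  have e : ‖f‖ₑ = ∫⁻ x, ‖f x‖ₑ ∂ν := by rw [Lp.enorm_def, eLpNorm_one_eq_lintegral_enorm]
  have key : ‖adjointJumpGenerator h hB f‖ₑ ≤ (2 * M : ℝ≥0) * ‖f‖ₑ := by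
    calc ‖adjointJumpGenerator h hB f‖ₑ = ∫⁻ x, ‖adjointJumpFun Λ Λs f x‖ₑ ∂ν := by
          rw [Lp.enorm_def, eLpNorm_one_eq_lintegral_enorm]
          refine lintegral_congr_ae ?_
          filter_upwards [coeFn_adjointJumpGenerator h hB f] with x hx
          rw [hx]
      _ ≤ ∫⁻ x, (∫⁻ y, ‖f y‖ₑ ∂(Λs x) + M * ‖f x‖ₑ) ∂ν := by
          refine lintegral_mono fun x => ?_
          refine (enorm_sub_le).trans (add_le_add (enorm_integral_le_lintegral_enorm _) ?_)
          rw [enorm_mul]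
          refine mul_le_mul_left ?_ _
          rw [Real.enorm_of_nonneg measureReal_nonneg]
          exact ENNReal.ofReal_le_of_le_toReal (by simpa using real_univ_le hM x)
      _ ≤ M * ‖f‖ₑ + M * ‖f‖ₑ := by
          rw [lintegral_add_right _ (hf.enorm.const_mul _), lintegral_const_mul _ hf.enorm, e]
          exact add_le_add (h.lintegral_enorm_le hM hf) le_rfl
      _ = (2 * M : ℝ≥0) * ‖f‖ₑ := by
          push_cast
          ring
  rw [enorm_eq_nnnorm, enorm_eq_nnnorm, ← ENNReal.coe_mul, ENNReal.coe_le_coe] at key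
  exact key

/-- The gain term is positive, and the loss rate is at most `M`. -/
theorem adjointJumpGenerator_add_smul_nonneg (hM : ∀ x, Λ x Set.univ ≤ M) {f : Lp ℝ 1 ν}
    (hf : 0 ≤ f) : 0 ≤ adjointJumpGenerator h hB f + (M : ℝ) • f := by
  have hf' := (Lp.coeFn_nonneg f).2 hf
  rw [← Lp.coeFn_nonneg]
  filter_upwards [coeFn_adjointJumpGenerator h hB f, hf', h.ae_ae hf',
    Lp.coeFn_add (adjointJumpGenerator h hB f) ((M : ℝ) • f), Lp.coeFn_smul (M : ℝ) f]
    with x h1 h2 h3 h4 h5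
  rw [h4, Pi.add_apply, h1, h5, Pi.smul_apply, smul_eq_mul, adjointJumpFun]
  have h6 : 0 ≤ ∫ y, f y ∂(Λs x) := integral_nonneg_of_ae h3
  have h7 := mul_le_mul_of_nonneg_right (real_univ_le hM x) h2
  simp only [Pi.zero_apply] at *
  linarith

/-- The adjoint relation for `F (x, y) = f x` says that total gain equals total loss. -/
theorem mass_adjointJumpGenerator_of_nonneg (hM : ∀ x, Λ x Set.univ ≤ M) {f : Lp ℝ 1 ν}
    (hf : 0 ≤ f) : mass ν (adjointJumpGenerator h hB f) = 0 := by
  have hm := Lp.stronglyMeasurable f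
  have hf' := (Lp.coeFn_nonneg f).2 hf
  have hloss : Integrable (fun x => (Λ x).real Set.univ * f x) ν := by
    refine (L1.integrable_coeFn f).bdd_mul (c := (M : ℝ))
      (Λ.measurable_coe MeasurableSet.univ).ennreal_toReal.aestronglyMeasurable ?_
    refine Eventually.of_forall fun x => ?_
    rw [Real.norm_of_nonneg measureReal_nonneg]
    exact real_univ_le hM x
  have hgain : Integrable (fun x => ∫ y, f y ∂(Λs x)) ν := by
    exact ((h.integrable_adjointJumpFun hM f).add hloss).congr
      (Eventually.of_forall fun x => by simp [adjointJumpFun])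
  rw [mass_apply, integral_congr_ae (coeFn_adjointJumpGenerator h hB f)]
  unfold adjointJumpFun
  rw [integral_sub hgain hloss, sub_eq_zero, integral_eq_lintegral_of_nonneg_ae _ hgain.1,
    integral_eq_lintegral_of_nonneg_ae _ hloss.1]
  · congr 1
    have e1 : ∫⁻ x, ENNReal.ofReal (∫ y, f y ∂(Λs x)) ∂ν =
        ∫⁻ x, ∫⁻ y, ENNReal.ofReal (f y) ∂(Λs x) ∂ν := by
      refine lintegral_congr_ae ?_
      filter_upwards [h.ae_ae hf', h.ae_integrable hM f] with x h1 h2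
      exact ofReal_integral_eq_lintegral_ofReal h2 h1
    rw [e1, ← h.lintegral_eq (fun q => ENNReal.ofReal (f q.1))
      (hm.measurable.ennreal_ofReal.comp measurable_fst)]
    refine lintegral_congr fun x => ?_
    simp only [lintegral_const]
    rw [ENNReal.ofReal_mul measureReal_nonneg, mul_comm, measureReal_def,
      ENNReal.ofReal_toReal ((hM x).trans_lt ENNReal.coe_lt_top).ne]
  · filter_upwards [hf'] with x hx
    exact mul_nonneg measureReal_nonneg hx
  · filter_upwards [h.ae_ae hf'] with x hx
    exact integral_nonneg_of_ae hx

theorem mass_adjointJumpGenerator (hM : ∀ x, Λ x Set.univ ≤ M) (f : Lp ℝ 1 ν) :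
    mass ν (adjointJumpGenerator h hB f) = 0 := by
  rw [← posPart_sub_negPart f, map_sub, map_sub,
    mass_adjointJumpGenerator_of_nonneg h hB hM (posPart_nonneg f),
    mass_adjointJumpGenerator_of_nonneg h hB hM (negPart_nonneg f), sub_zero]

theorem adjointJumpGenerator_indicatorL1 [IsFiniteMeasure ν] {s : Set X} (hs : MeasurableSet s) :
    adjointJumpGenerator h hB (indicatorL1 ν hs) =ᵐ[ν] fun x =>
      (Λs x).real s - (Λ x).real Set.univ * s.indicator (fun _ => 1) x := by
  have hi := coeFn_indicatorL1 (ν := ν) hs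
  filter_upwards [coeFn_adjointJumpGenerator h hB (indicatorL1 ν hs), hi, h.ae_ae hi]
    with x h1 h2 h3
  rw [h1, adjointJumpFun, h2, integral_congr_ae h3]
  simp [integral_indicator hs]

end AdjointJumpGenerator

/-! ### The jump part of the particle system -/

section JumpParticle

variable {X : Type*} [MeasurableSpace X] {n : ℕ}

/-- The jump kernel of a particle, jointly in its position and the other particles. -/
def EmpiricalJumpKernel.joint (Λ : EmpiricalJumpKernel X n) : Kernel ((Fin n → X) × X) X where
  toFun p := Λ.kernel (toEmpirical p.1) p.2
  measurable' := by
    refine Measure.measurable_of_measurable_coe _ fun E hE => ?_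
    have hsw : Measurable (Prod.swap : (Fin n → X) × X → X × (Fin n → X)) := measurable_swap
    have h := (Λ.measurable E hE).comp hsw
    exact h

theorem EmpiricalJumpKernel.joint_apply (Λ : EmpiricalJumpKernel X n) (p : (Fin n → X) × X) :
    Λ.joint p = Λ.kernel (toEmpirical p.1) p.2 := rfl

open Classical in
/-- The distribution after a jump from the set `s` under `ν`, depending on the other particles. -/
def EmpiricalJumpKernel.jumpFrom (Λ : EmpiricalJumpKernel X n) (ν : Measure X)
    {s : Set ((Fin n → X) × X)} (hs : MeasurableSet s) : Kernel (Fin n → X) X :=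
  Kernel.snd (Kernel.const (Fin n → X) ν ⊗ₖ Kernel.piecewise hs Λ.joint 0)

variable {ν : Measure X} {Λ : EmpiricalJumpKernel X n} {Λs : empiricalMeasures X n → Kernel X X}

theorem BoundedIntensity.isFiniteKernel_joint (h : BoundedIntensity ν Λ Λs) :
    IsFiniteKernel Λ.joint := by
  obtain ⟨M, hM⟩ := h.bound
  exact ⟨M, ENNReal.coe_lt_top, fun p => hM _ _⟩

variable [IsFiniteMeasure ν]

theorem BoundedIntensity.isFiniteKernel_jumpFrom (h : BoundedIntensity ν Λ Λs)
    {s : Set ((Fin n → X) × X)} (hs : MeasurableSet s) : IsFiniteKernel (Λ.jumpFrom ν hs) := by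
  have := h.isFiniteKernel_joint
  unfold EmpiricalJumpKernel.jumpFrom
  infer_instance

/-- The adjoint relation for the product of the indicators of a section of `s` and of `E`. The left
side is a kernel in `z`, although `Λs (toEmpirical z)` need not depend measurably on `z`. -/
theorem BoundedIntensity.jumpFrom_eq_withDensity (h : BoundedIntensity ν Λ Λs)
    {s : Set ((Fin n → X) × X)} (hs : MeasurableSet s) (z : Fin n → X) :
    Λ.jumpFrom ν hs z = ν.withDensity fun y => Λs (toEmpirical z) y {x | (z, x) ∈ s} := by
  classical
  have := h.isFiniteKernel_joint
  have hsz : MeasurableSet {x | (z, x) ∈ s} := measurable_prodMk_left hs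
  ext E hE
  rw [withDensity_apply _ hE, EmpiricalJumpKernel.jumpFrom, Kernel.snd_apply' _ _ hE,
    Kernel.compProd_apply (measurable_snd hE), Kernel.const_apply]
  have key := (h.adjoint (toEmpirical z)).lintegral_eq
    (fun q => {x | (z, x) ∈ s}.indicator 1 q.1 * E.indicator 1 q.2)
    (((measurable_one.indicator hsz).comp measurable_fst).mul
      ((measurable_one.indicator hE).comp measurable_snd))
  have hm1 : Measurable (E.indicator (1 : X → ℝ≥0∞)) := measurable_one.indicator hE
  have hm2 : Measurable ({x | (z, x) ∈ s}.indicator (1 : X → ℝ≥0∞)) := measurable_one.indicator hsz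
  simp only [lintegral_const_mul _ hm1, lintegral_mul_const _ hm2,
    lintegral_indicator_one hE, lintegral_indicator_one hsz] at key
  rw [← lintegral_indicator hE]
  refine Eq.trans ?_ (key.trans ?_)
  · refine lintegral_congr fun x => ?_
    rw [Kernel.piecewise_apply']
    by_cases hx : (z, x) ∈ s
    · simp [hx, EmpiricalJumpKernel.joint_apply, Set.preimage_preimage]
    · simp [hx]
  · refine lintegral_congr fun y => ?_
    by_cases hy : y ∈ E <;> simp [hy]

variable [MeasurableSpace.CountablyGenerated X]

/-- The jump operator of a bounded intensity is defined on indicator functions. -/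
theorem BoundedIntensity.indicatorL1_mem_domain (h : BoundedIntensity ν Λ Λs) (k : Fin (n + 1))
    {A : Set (Fin (n + 1) → X)} (hA : MeasurableSet A) :
    ∃ η, (indicatorL1 (prodMeasure ν (n + 1)) hA, η) ∈ fiberwiseGraph ν
      (fun z => adjointJumpGenerator (h.adjoint (toEmpirical z)) (Λ.bounded (toEmpirical z))) k := by
  have := h.isFiniteKernel_joint
  obtain ⟨M, hM⟩ := h.bound
  let s : Set ((Fin n → X) × X) := {p | (k.insertNth p.2 p.1 : Fin (n + 1) → X) ∈ A}
  have hs : MeasurableSet s := ((measurable_insertNth k).comp measurable_swap) hA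
  have hsz : ∀ z, MeasurableSet {x | (z, x) ∈ s} := fun z => measurable_prodMk_left hs
  have := h.isFiniteKernel_jumpFrom hs
  let κ := Λ.jumpFrom ν hs
  -- For each `z` this is almost everywhere the gain term of the section of `A`, but it is jointly
  -- measurable in the configuration and the position.
  let r := Kernel.rnDeriv κ (Kernel.const (Fin n → X) ν)
  have hr : ∀ z, r z =ᵐ[ν] fun y => Λs (toEmpirical z) y {x | (z, x) ∈ s} := by
    intro z
    refine (Kernel.rnDeriv_eq_rnDeriv_measure (κ := κ) (η := Kernel.const (Fin n → X) ν)).trans ?_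
    simp only [κ, Kernel.const_apply, h.jumpFrom_eq_withDensity hs z]
    exact Measure.rnDeriv_withDensity ν ((Λs (toEmpirical z)).measurable_coe (hsz z))
  have hsplit : Measurable fun x : Fin (n + 1) → X => (k.removeNth x, x k) :=
    ((MeasurableEquiv.piFinSuccAbove (fun _ : Fin (n + 1) => X) k).measurable).snd.prodMk
      (measurable_pi_apply k)
  have hrm : Measurable fun x : Fin (n + 1) → X => r (k.removeNth x) (x k) :=
    (Kernel.measurable_rnDeriv κ (Kernel.const (Fin n → X) ν)).comp hsplit
  have hgain : Integrable (fun x : Fin (n + 1) → X => (r (k.removeNth x) (x k)).toReal)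
      (prodMeasure ν (n + 1)) := by
    refine integrable_toReal_of_lintegral_ne_top hrm.aemeasurable ?_
    rw [← lintegral_slice k hrm]
    simp only [Fin.removeNth_insertNth, Fin.insertNth_apply_same]
    refine ((lintegral_mono fun z => ?_).trans_lt
      (by simpa using ENNReal.mul_lt_top (Kernel.bound_lt_top κ) (measure_lt_top _ _) :
        ∫⁻ _, κ.bound ∂(prodMeasure ν n) < ∞)).ne
    calc ∫⁻ y, r z y ∂ν = κ z Set.univ := by
          rw [lintegral_congr_ae (hr z)]
          simp only [κ]
          rw [h.jumpFrom_eq_withDensity hs z, withDensity_apply _ .univ, Measure.restrict_univ]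
      _ ≤ κ.bound := Kernel.measure_le_bound κ z _
  have hloss : Integrable (fun x : Fin (n + 1) → X =>
      (Λ.joint (k.removeNth x, x k)).real Set.univ * A.indicator (fun _ => 1) x)
      (prodMeasure ν (n + 1)) := by
    refine ((integrable_const (μ := prodMeasure ν (n + 1)) (1 : ℝ)).indicator hA).bdd_mul (c := (M : ℝ))
      ((Λ.joint.measurable_coe .univ).comp hsplit).ennreal_toReal.aestronglyMeasurable ?_
    refine Eventually.of_forall fun x => ?_
    rw [Real.norm_of_nonneg measureReal_nonneg]
    exact real_univ_le (κ := Λ.joint) (fun p => hM _ _) _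
  refine ⟨(hgain.sub hloss).toL1 _, ?_⟩
  rw [mem_fiberwiseGraph]
  filter_upwards [ae_slice ν k (coeFn_indicatorL1 (ν := prodMeasure ν (n + 1)) hA),
    ae_slice ν k (hgain.sub hloss).coeFn_toL1] with z h1 h2
  refine ⟨indicatorL1 ν (hsz z), ?_, ?_⟩
  · filter_upwards [h1, coeFn_indicatorL1 (ν := ν) (hsz z)] with y a1 a2
    rw [a1, a2]
    rfl
  · filter_upwards [h2, hr z, adjointJumpGenerator_indicatorL1 (h.adjoint (toEmpirical z))
      (Λ.bounded (toEmpirical z)) (hsz z)] with y a1 a2 a3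
    rw [a1, a3, Pi.sub_apply, Fin.removeNth_insertNth, Fin.insertNth_apply_same, a2]
    rfl

/-- The jump operator of a bounded intensity is a bounded operator on `L¹(ν^{⊗(n+1)})`. -/
theorem BoundedIntensity.exists_jump_operator (h : BoundedIntensity ν Λ Λs) :
    ∃ M : ℝ, ∀ k : Fin (n + 1),
      ∃ F : Lp ℝ 1 (prodMeasure ν (n + 1)) →L[ℝ] Lp ℝ 1 (prodMeasure ν (n + 1)),
        (∀ ρ η, (ρ, η) ∈ (jumpParticle ν h k).graph ↔ η = F ρ) ∧
        (∀ ρ, 0 ≤ ρ → 0 ≤ F ρ + M • ρ) ∧ ∀ ρ, mass (prodMeasure ν (n + 1)) (F ρ) = 0 := by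
  obtain ⟨M, hM⟩ := h.bound
  refine ⟨M, fun k => ?_⟩
  have hB := fun z f => norm_adjointJumpGenerator_le (h.adjoint (toEmpirical z))
    (Λ.bounded (toEmpirical z)) (hM (toEmpirical z)) f
  obtain ⟨F, hF⟩ := exists_fiberwise (k := k) hB (eq_top_of_indicatorL1_mem
    (Submodule.isClosed_topologicalClosure _) fun s hs => by
      obtain ⟨η, hη⟩ := h.indicatorL1_mem_domain k hs
      exact Submodule.le_topologicalClosure _ ⟨_, hη, rfl⟩)
  refine ⟨F, fun ρ η => ?_, fun ρ hρ => ?_, fun ρ => ?_⟩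
  · rw [jumpParticle, fiberwise, Submodule.toLinearPMap_graph_eq _
      (fun p => fiberwiseGraph_snd_eq_zero ν _ k p)]
    exact hF ρ η
  · exact nonneg_of_mem_fiberwiseGraph (fun z f hf => adjointJumpGenerator_add_smul_nonneg _ _
      (hM (toEmpirical z)) hf) ((hF ρ (F ρ)).2 rfl) hρ
  · simpa using mass_of_mem_fiberwiseGraph (c := 0) (fun z f => by
      rw [mass_adjointJumpGenerator _ _ (hM (toEmpirical z)), zero_mul]) ((hF ρ (F ρ)).2 rfl)

end JumpParticle

/-! ### Independent particles -/

section Independent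

variable {X : Type*} [MeasurableSpace X] {ν : Measure X} [IsFiniteMeasure ν]

/-- An `ε/3` argument; it reduces strong continuity of the coordinate semigroups to tensor products.
-/
theorem tendsto_of_total {E : Type*} [NormedAddCommGroup E] [NormedSpace ℝ E] {ι : Type*}
    {l : Filter ι} {P : ι → E →L[ℝ] E} (hb : ∀ i x, ‖P i x‖ ≤ ‖x‖) {s : Set E}
    (hs : (Submodule.span ℝ s).topologicalClosure = ⊤)
    (h : ∀ x ∈ s, Tendsto (fun i => P i x) l (𝓝 x)) (x : E) : Tendsto (fun i => P i x) l (𝓝 x) := by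
  have hspan : ∀ x ∈ Submodule.span ℝ s, Tendsto (fun i => P i x) l (𝓝 x) := by
    intro x hx
    induction hx using Submodule.span_induction with
    | mem x hx => exact h x hx
    | zero => simpa using tendsto_const_nhds
    | add x y _ _ hx hy => simpa using hx.add hy
    | smul c x _ hx => simpa using hx.const_smul c
  rw [Metric.tendsto_nhds]
  intro ε hε
  have hx : x ∈ closure (Submodule.span ℝ s : Set E) := by
    rw [← Submodule.topologicalClosure_coe, hs]
    trivial
  obtain ⟨y, hy, hxy⟩ := Metric.mem_closure_iff.1 hx (ε / 3) (by positivity)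
  filter_upwards [Metric.tendsto_nhds.1 (hspan y hy) (ε / 3) (by positivity)] with i hi
  have h1 : dist (P i x) (P i y) ≤ dist x y := by
    rw [dist_eq_norm, dist_eq_norm, ← map_sub]
    exact hb i _
  linarith [dist_triangle4 (P i x) (P i y) y x, dist_comm x y]

variable {S : ℝ≥0 → Lp ℝ 1 ν →L[ℝ] Lp ℝ 1 ν} {n : ℕ}

/-- A semigroup acting on the `k`-th coordinate. -/
theorem IsAdjointMarkovSemigroup.exists_coordinate (hS : IsAdjointMarkovSemigroup ν S)
    (k : Fin (n + 1)) :
    ∃ T : ℝ≥0 → Lp ℝ 1 (prodMeasure ν (n + 1)) →L[ℝ] Lp ℝ 1 (prodMeasure ν (n + 1)),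
      IsAdjointMarkovSemigroup (prodMeasure ν (n + 1)) T ∧
      ∀ t f, T t (tensor ν f) = tensor ν (Function.update f k (S t (f k))) := by
  choose T hT hpos hmass using fun t =>
    exists_coordinate_operator k (S t) (hS.nonneg t) (hS.integral_eq t)
  refine ⟨T, ⟨⟨?_, fun s t => ?_, ?_⟩, hpos, hmass⟩, hT⟩
  -- The semigroup laws are identities between bounded operators, so tensor products suffice.
  · refine continuousLinearMap_ext_tensor fun f => ?_
    simp [hT, hS.map_zero]
  · refine continuousLinearMap_ext_tensor fun f => ?_
    simp [hT, hS.map_add]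
  · refine tendsto_of_total (fun t => norm_le_of_positive_of_mass (hpos t) (hmass t))
      (span_tensor_topologicalClosure dense_univ) ?_
    rintro _ ⟨f, _, rfl⟩
    simp only [hT]
    have h1 : Tendsto (fun t => Function.update f k (S t (f k))) (𝓝 0) (𝓝 f) := by
      simpa using (tendsto_const_nhds (x := f)).update k (hS.tendsto_zero (f k))
    exact ((tensorCMM ν (n + 1)).cont.tendsto f).comp h1

/-- The generator of a semigroup acting on the `k`-th coordinate, on tensor products. -/
theorem isGen_tensor {k : Fin (n + 1)}
    {T : ℝ≥0 → Lp ℝ 1 (prodMeasure ν (n + 1)) →L[ℝ] Lp ℝ 1 (prodMeasure ν (n + 1))}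
    (hT : ∀ t f, T t (tensor ν f) = tensor ν (Function.update f k (S t (f k))))
    {f : Fin (n + 1) → Lp ℝ 1 ν} {g : Lp ℝ 1 ν} (h : IsGen S (f k) g) :
    IsGen T (tensor ν f) (tensor ν (Function.update f k g)) := by
  have h1 := (tendsto_const_nhds (x := f)).update k h
  refine (((tensorCMM ν (n + 1)).cont.tendsto _).comp h1).congr fun t => ?_
  have h2 := (tensorCMM ν (n + 1)).toMultilinearMap.map_update_smul f k (t : ℝ)⁻¹ (S t (f k) - f k)
  have h3 := (tensorCMM ν (n + 1)).toMultilinearMap.map_update_sub f k (S t (f k)) (f k)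
  rw [h3, Function.update_eq_self] at h2
  rw [hT]
  exact h2

/-- The span lies in the closed graph of a generator, and so does its closure. Equality with that
generator is not needed for the sum. -/
theorem singleParticle_graph_le {K : Lp ℝ 1 ν →ₗ.[ℝ] Lp ℝ 1 ν}
    (hK : IsInfinitesimalGenerator S K) {k : Fin (n + 1)}
    {T : ℝ≥0 → Lp ℝ 1 (prodMeasure ν (n + 1)) →L[ℝ] Lp ℝ 1 (prodMeasure ν (n + 1))}
    (hTs : IsAdjointMarkovSemigroup (prodMeasure ν (n + 1)) T)
    (hT : ∀ t f, T t (tensor ν f) = tensor ν (Function.update f k (S t (f k)))) :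
    (singleParticle ν K k).graph ≤ genGraph T ∧
    ∀ f g, (f k, g) ∈ K.graph →
      (tensor ν f, tensor ν (Function.update f k g)) ∈ (singleParticle ν K k).graph := by
  have hle : (Submodule.span ℝ {p | ∃ (f : Fin (n + 1) → Lp ℝ 1 ν) (g : Lp ℝ 1 ν),
      (f k, g) ∈ K.graph ∧ p = (tensor ν f, tensor ν (Function.update f k g))}).topologicalClosure ≤
      genGraph T := by
    refine Submodule.topologicalClosure_minimal _ (Submodule.span_le.2 ?_)
      (hTs.toIsC0Semigroup.isClosed_genGraph hTs.norm_le)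
    rintro _ ⟨f, g, hg, rfl⟩
    exact isGen_tensor hT ((hK _ _).1 hg)
  -- `Submodule.toLinearPMap` has the given graph only for a single-valued relation; this is
  -- inherited from the generator of `T`.
  have e : (singleParticle ν K k).graph = _ := Submodule.toLinearPMap_graph_eq _ fun p hp h0 => by
    have h1 : IsGen T p.1 p.2 := hle hp
    rw [h0] at h1
    exact h1.unique (genGraph T).zero_mem
  rw [e]
  exact ⟨hle, fun f g hg =>
    Submodule.le_topologicalClosure _ (Submodule.subset_span ⟨f, g, hg, rfl⟩)⟩

/-- The semigroup of independent particles, acting on the coordinates in `s`. -/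
theorem IsAdjointMarkovSemigroup.exists_prod
    {T : Fin (n + 1) → ℝ≥0 → Lp ℝ 1 (prodMeasure ν (n + 1)) →L[ℝ] Lp ℝ 1 (prodMeasure ν (n + 1))}
    (hTs : ∀ k, IsAdjointMarkovSemigroup (prodMeasure ν (n + 1)) (T k))
    (hT : ∀ k t f, T k t (tensor ν f) = tensor ν (Function.update f k (S t (f k))))
    (s : Finset (Fin (n + 1))) :
    ∃ P : ℝ≥0 → Lp ℝ 1 (prodMeasure ν (n + 1)) →L[ℝ] Lp ℝ 1 (prodMeasure ν (n + 1)),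
      IsAdjointMarkovSemigroup (prodMeasure ν (n + 1)) P ∧
      (∀ t f, P t (tensor ν f) = tensor ν fun i => if i ∈ s then S t (f i) else f i) ∧
      ∀ ρ (η : Fin (n + 1) → Lp ℝ 1 (prodMeasure ν (n + 1))), (∀ k ∈ s,
        IsGen (T k) ρ (η k)) → IsGen P ρ (∑ k ∈ s, η k) := by
  induction s using Finset.induction_on with
  | empty =>
    refine ⟨fun _ => ContinuousLinearMap.id ℝ _, ⟨⟨rfl, fun _ _ => rfl, fun _ => ?_⟩,
      fun _ _ h => h, fun _ _ => rfl⟩, fun t f => by simp, fun ρ η _ => ?_⟩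
    · exact tendsto_const_nhds
    · simp [IsGen]
  | insert k s hk ih =>
    obtain ⟨P, hP, hPt, hPg⟩ := ih
    have hcomm : ∀ r t x, T k r (P t x) = P t (T k r x) := by
      intro r t x
      refine DFunLike.congr_fun (continuousLinearMap_ext_tensor
        (P := (T k r).comp (P t)) (Q := (P t).comp (T k r)) fun f => ?_) x
      simp only [ContinuousLinearMap.comp_apply, hPt, hT, hk, if_false]
      congr 1
      ext1 i
      by_cases hi : i = k
      · subst hi
        simp [hk]
      · simp [hi]
    refine ⟨fun t => (T k t).comp (P t), ⟨(hTs k).toIsC0Semigroup.comp (hTs k).norm_le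
      hP.toIsC0Semigroup hcomm, fun t ρ hρ => (hTs k).nonneg t _ (hP.nonneg t ρ hρ), fun t ρ =>
      ((hTs k).integral_eq t _).trans (hP.integral_eq t ρ)⟩, fun t f => ?_, fun ρ η h => ?_⟩
    · simp only [ContinuousLinearMap.comp_apply, hPt, hT, hk, if_false]
      congr 1
      ext1 i
      by_cases hi : i = k
      · subst hi
        simp
      · simp [hi]
    · rw [Finset.sum_insert hk, add_comm (η k)]
      exact IsGen.comp (hTs k).toIsC0Semigroup (hTs k).norm_le (h k (Finset.mem_insert_self _ _))
        (hPg ρ η fun j hj => h j (Finset.mem_insert_of_mem hj))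

/-- The span of the tensor products of functions in the domain of `K`, with the values of
`∑ₖ I ⊗ ⋯ ⊗ K ⊗ ⋯ ⊗ I`. -/
def tensorCore (ν : Measure X) [IsFiniteMeasure ν] (N : ℕ) (K : Lp ℝ 1 ν →ₗ.[ℝ] Lp ℝ 1 ν) :
    Submodule ℝ (Lp ℝ 1 (prodMeasure ν N) × Lp ℝ 1 (prodMeasure ν N)) :=
  Submodule.span ℝ {p | ∃ f g : Fin N → Lp ℝ 1 ν, (∀ k, (f k, g k) ∈ K.graph) ∧
    p = (tensor ν f, ∑ k, tensor ν (Function.update f k (g k)))}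

/-- The semigroup `P` sends the tensor of the `f i` to that of the `S t (f i)`, which stay in the
domain of `K` with `K (S t (f i)) = S t (g i)`. The span is thus invariant, and it is dense because
the domain of `K` is. -/
theorem tensorCore_isCore (hS : IsAdjointMarkovSemigroup ν S) {K : Lp ℝ 1 ν →ₗ.[ℝ] Lp ℝ 1 ν}
    (hK : IsInfinitesimalGenerator S K)
    {T : Fin (n + 1) → ℝ≥0 → Lp ℝ 1 (prodMeasure ν (n + 1)) →L[ℝ] Lp ℝ 1 (prodMeasure ν (n + 1))}
    (hT : ∀ k t f, T k t (tensor ν f) = tensor ν (Function.update f k (S t (f k))))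
    {P : ℝ≥0 → Lp ℝ 1 (prodMeasure ν (n + 1)) →L[ℝ] Lp ℝ 1 (prodMeasure ν (n + 1))}
    (hP : IsAdjointMarkovSemigroup (prodMeasure ν (n + 1)) P)
    (hPt : ∀ t f, P t (tensor ν f) = tensor ν fun i => S t (f i))
    (hPg : ∀ ρ (η : Fin (n + 1) → Lp ℝ 1 (prodMeasure ν (n + 1))), (∀ k, IsGen (T k) ρ (η k)) →
      IsGen P ρ (∑ k, η k)) :
    genGraph P ≤ (tensorCore ν (n + 1) K).topologicalClosure := by
  refine hP.toIsC0Semigroup.genGraph_le_closure hP.norm_le _ ?_ ?_ ?_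
  · refine Submodule.span_le.2 ?_
    rintro _ ⟨f, g, hfg, rfl⟩
    exact hPg _ _ fun k => isGen_tensor (hT k) ((hK _ _).1 (hfg k))
  · intro t p hp
    suffices h : tensorCore ν (n + 1) K ≤ (tensorCore ν (n + 1) K).comap
        (((P t : _ →ₗ[ℝ] _)).prodMap (P t : _ →ₗ[ℝ] _)) from h hp
    refine Submodule.span_le.2 ?_
    rintro _ ⟨f, g, hfg, rfl⟩
    have e : P t (∑ k, tensor ν (Function.update f k (g k))) =
        ∑ k, tensor ν (Function.update (fun i => S t (f i)) k (S t (g k))) := by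
      rw [map_sum]
      refine Finset.sum_congr rfl fun k _ => ?_
      rw [hPt]
      congr 1
      ext1 i
      by_cases hi : i = k
      · subst hi
        simp
      · simp [hi]
    exact Submodule.subset_span ⟨fun i => S t (f i), fun i => S t (g i),
      fun k => (hK _ _).2 (IsGen.map hS.toIsC0Semigroup ((hK _ _).1 (hfg k)) t),
      Prod.ext (hPt t f) e⟩
  · have hD := hS.toIsC0Semigroup.dense_domain (hS.toIsC0Semigroup.continuous hS.norm_le)
    have h1 := span_tensor_topologicalClosure (N := n + 1) hD
    rw [← Submodule.dense_iff_topologicalClosure_eq_top] at h1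
    refine h1.mono ?_
    change _ ≤ (tensorCore ν (n + 1) K).map (LinearMap.fst ℝ _ _)
    refine Submodule.span_le.2 ?_
    rintro _ ⟨f, hf, rfl⟩
    choose g hg using hf
    exact ⟨_, Submodule.subset_span ⟨f, g, fun k => (hK _ _).2 (hg k), rfl⟩, rfl⟩

end Independent

/-! ### The interacting system -/

theorem mem_graph_add {E F : Type*} [AddCommGroup E] [Module ℝ E] [AddCommGroup F] [Module ℝ F]
    {f g : E →ₗ.[ℝ] F} {x : E} {y : F} :
    (x, y) ∈ (f + g).graph ↔ ∃ a b, (x, a) ∈ f.graph ∧ (x, b) ∈ g.graph ∧ y = a + b := by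
  constructor
  · intro h
    obtain ⟨z, hz, hz'⟩ := LinearPMap.mem_graph_iff _ |>.1 h
    simp only at hz hz'
    subst hz
    exact ⟨_, _, f.mem_graph ⟨z, z.2.1⟩, g.mem_graph ⟨z, z.2.2⟩, by rw [← hz']; rfl⟩
  · rintro ⟨a, b, ha, hb, rfl⟩
    obtain ⟨u, hu, rfl⟩ := LinearPMap.mem_graph_iff _ |>.1 ha
    obtain ⟨v, hv, rfl⟩ := LinearPMap.mem_graph_iff _ |>.1 hb
    simp only at hu hv
    subst hu
    have h := (f + g).mem_graph ⟨u, u.2, hv ▸ v.2⟩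
    have e : g ⟨u, hv ▸ v.2⟩ = g v := congrArg g (Subtype.ext hv.symm)
    rw [LinearPMap.add_apply, e] at h
    exact h

theorem mem_graph_sum {E F ι : Type*} [AddCommGroup E] [Module ℝ E] [AddCommGroup F] [Module ℝ F]
    {f : ι → E →ₗ.[ℝ] F} {s : Finset ι} {x : E} {y : F} :
    (x, y) ∈ (∑ i ∈ s, f i).graph ↔ ∃ a : ι → F, (∀ i ∈ s, (x, a i) ∈ (f i).graph) ∧
      y = ∑ i ∈ s, a i := by
  classical
  induction s using Finset.induction_on generalizing y with
  | empty =>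
    simp only [Finset.sum_empty, Finset.notMem_empty, false_implies, implies_true, true_and,
      exists_const, LinearPMap.mem_graph_iff, LinearPMap.zero_apply]
    exact ⟨fun ⟨_, _, h⟩ => h.symm, fun h => ⟨⟨x, trivial⟩, rfl, h.symm⟩⟩
  | insert k s hk ih =>
    rw [Finset.sum_insert hk, mem_graph_add]
    constructor
    · rintro ⟨a, b, ha, hb, rfl⟩
      obtain ⟨c, hc, rfl⟩ := ih.1 hb
      refine ⟨Function.update c k a, fun i hi => ?_, ?_⟩
      · rcases Finset.mem_insert.1 hi with rfl | hi
        · simpa using ha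
        · rw [Function.update_of_ne (ne_of_mem_of_not_mem hi hk)]
          exact hc i hi
      · rw [Finset.sum_insert hk, Function.update_self]
        congr 1
        refine Finset.sum_congr rfl fun i hi => ?_
        rw [Function.update_of_ne (ne_of_mem_of_not_mem hi hk)]
    · rintro ⟨a, ha, rfl⟩
      exact ⟨a k, _, ha k (Finset.mem_insert_self _ _),
        ih.2 ⟨a, fun i hi => ha i (Finset.mem_insert_of_mem hi), rfl⟩, Finset.sum_insert hk⟩

section Interacting

variable {X : Type*} [MeasurableSpace X] {ν : Measure X}

/-- Bounded perturbation theorem for adjoint Markov semigroups. -/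
theorem IsAdjointMarkovSemigroup.exists_perturbation {T : ℝ≥0 → Lp ℝ 1 ν →L[ℝ] Lp ℝ 1 ν}
    (hT : IsAdjointMarkovSemigroup ν T) (A : Lp ℝ 1 ν →L[ℝ] Lp ℝ 1 ν) {M : ℝ}
    (hA : ∀ ρ, 0 ≤ ρ → 0 ≤ A ρ + M • ρ) (hmass : ∀ ρ, mass ν (A ρ) = 0) :
    ∃ U : ℝ≥0 → Lp ℝ 1 ν →L[ℝ] Lp ℝ 1 ν, IsAdjointMarkovSemigroup ν U ∧
      ∀ ρ η, IsGen U ρ (η + A ρ) ↔ IsGen T ρ η := by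
  obtain ⟨U, hU, hc, hpos, hgen⟩ :=
    hT.toIsC0Semigroup.exists_perturbation hT.norm_le hT.nonneg A hA
  refine ⟨U, ⟨hU, hpos, hU.map_eq_of_isGen hc (mass ν) fun ρ η h => ?_⟩, hgen⟩
  have h1 : IsGen T ρ (η - A ρ) := (hgen _ _).1 (by rwa [sub_add_cancel])
  -- The difference quotients of the mass-conserving `T` have mass zero.
  have h2 : mass ν (η - A ρ) = 0 := by
    refine tendsto_nhds_unique (((mass ν).continuous.tendsto _).comp h1) ?_
    refine tendsto_const_nhds.congr fun t => ?_
    have h3 : mass ν (T t ρ) = mass ν ρ := hT.integral_eq t ρ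
    simp [h3]
  rwa [map_sub, hmass, sub_zero] at h2

end Interacting

end MeanFieldJump

end

theorem proposition2p12 {X : Type*} [TopologicalSpace X] [PolishSpace X] [MeasurableSpace X]
    [BorelSpace X] (ν : MeasureTheory.Measure X) [MeasureTheory.IsFiniteMeasure ν]
    (n : ℕ) (hn : 1 ≤ n)
    (K : MeasureTheory.Lp ℝ 1 ν →ₗ.[ℝ] MeasureTheory.Lp ℝ 1 ν)
    (hK : MeanFieldJump.IsAdjointMarkovGenerator ν K)
    (Λ : MeanFieldJump.EmpiricalJumpKernel X n)
    (Λs : MeanFieldJump.empiricalMeasures X n → ProbabilityTheory.Kernel X X)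
    (hΛ : MeanFieldJump.BoundedIntensity ν Λ Λs) :
    MeanFieldJump.IsAdjointMarkovGenerator (MeanFieldJump.prodMeasure ν (n + 1))
      (MeanFieldJump.nParticleGenerator ν K hΛ) := by
  open MeanFieldJump in
  obtain ⟨S, hS, hSK⟩ := hK
  choose T hTs hT using fun k : Fin (n + 1) => hS.exists_coordinate k
  obtain ⟨P, hP, hPt, hPg⟩ := IsAdjointMarkovSemigroup.exists_prod hTs hT Finset.univ
  simp only [Finset.mem_univ, if_true, true_implies] at hPt hPg
  obtain ⟨M, hM⟩ := hΛ.exists_jump_operator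
  choose F hF hFpos hFmass using hM
  -- Each of the `n + 1` jump operators needs a shift by `M` to become positive.
  obtain ⟨U, hU, hUgen⟩ := hP.exists_perturbation (∑ k, F k) (M := (n + 1 : ℕ) * M)
    (fun ρ hρ => by
      have e : (∑ k, F k) ρ + ((n + 1 : ℕ) * M) • ρ = ∑ k, (F k ρ + M • ρ) := by
        rw [sum_apply, Finset.sum_add_distrib, Finset.sum_const,
          Finset.card_univ, Fintype.card_fin, mul_smul, Nat.cast_smul_eq_nsmul]
      rw [e]
      exact Finset.sum_nonneg fun k _ => hFpos k ρ hρ)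
    (fun ρ => by
      rw [sum_apply, map_sum]
      exact Finset.sum_eq_zero fun k _ => hFmass k ρ)
  have hsingle := fun k => singleParticle_graph_le hSK (hTs k) (hT k)
  have hgraph : (∑ k, (singleParticle ν K k + jumpParticle ν hΛ k)).graph.topologicalClosure =
      genGraph U := by
    refine le_antisymm (Submodule.topologicalClosure_minimal _ ?_
      (hU.toIsC0Semigroup.isClosed_genGraph hU.norm_le)) ?_
    · rintro ⟨ρ, η⟩ h
      obtain ⟨a, ha, rfl⟩ := mem_graph_sum.1 h
      choose b c hb hc hbc using fun k => mem_graph_add.1 (ha k (Finset.mem_univ k))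
      have h1 := (hUgen ρ _).2 (hPg ρ b fun k => (hsingle k).1 (hb k))
      refine h1.congr ?_
      rw [sum_apply, ← Finset.sum_add_distrib]
      exact Finset.sum_congr rfl fun k _ => by rw [hbc, (hF k _ _).1 (hc k)]
    · rintro ⟨ρ, η⟩ h
      have h1 : (ρ, η - (∑ k, F k) ρ) ∈ (tensorCore ν (n + 1) K).topologicalClosure :=
        tensorCore_isCore hS hSK hT hP hPt hPg
          ((hUgen _ _).1 (show IsGen U ρ (η - (∑ k, F k) ρ + (∑ k, F k) ρ) by
            rwa [sub_add_cancel]))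
      -- The shear `(ρ, η) ↦ (ρ, η + A ρ)` carries the generator of `P` to that of `U`. Being
      -- continuous, it maps the closure of the core into the closure of the graph of the sum.
      let Φ := (ContinuousLinearMap.fst ℝ (MeasureTheory.Lp ℝ 1 (prodMeasure ν (n + 1)))
        (MeasureTheory.Lp ℝ 1 (prodMeasure ν (n + 1)))).prod (ContinuousLinearMap.snd ℝ _ _ +
          (∑ k, F k).comp (ContinuousLinearMap.fst ℝ _ _))
      have hΦ : tensorCore ν (n + 1) K ≤
          (∑ k, (singleParticle ν K k + jumpParticle ν hΛ k)).graph.comap (Φ : _ →ₗ[ℝ] _) := by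
        refine Submodule.span_le.2 ?_
        rintro _ ⟨f, g, hfg, rfl⟩
        refine mem_graph_sum.2 ⟨fun k => tensor ν (Function.update f k (g k)) + F k (tensor ν f),
          fun k _ => mem_graph_add.2 ⟨_, _, (hsingle k).2 f (g k) (hfg k), (hF k _ _).2 rfl, rfl⟩,
          ?_⟩
        rw [Finset.sum_add_distrib, ← sum_apply]
        rfl
      have hmaps : Set.MapsTo Φ (tensorCore ν (n + 1) K)
          (∑ k, (singleParticle ν K k + jumpParticle ν hΛ k)).graph := fun p hp => hΦ hp
      have h2 := map_mem_closure Φ.continuous h1 hmaps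
      have e : Φ (ρ, η - (∑ k, F k) ρ) = (ρ, η) := by simp [Φ]
      rw [e] at h2
      exact h2
  -- `LinearPMap.closure` leaves a non-closable operator unchanged, so closability must be shown; it
  -- holds because the closure of the graph is the single-valued `genGraph U`.
  have hclosable : (∑ k, (singleParticle ν K k + jumpParticle ν hΛ k)).IsClosable := by
    refine ⟨(genGraph U).toLinearPMap, ?_⟩
    rw [Submodule.toLinearPMap_graph_eq, hgraph]
    rintro ⟨ρ, η⟩ h h0
    have h1 : IsGen U ρ η := h
    simp only at h0
    rw [h0] at h1
    exact h1.unique (genGraph U).zero_mem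
  refine ⟨U, hU, fun ρ η => ?_⟩
  rw [nParticleGenerator, ← hclosable.graph_closure_eq_closure_graph, hgraph]
  exact Iff.rfl
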